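/- Let $S\subset\mathbb{R}^n$ be a semialgebraic set of dimension $d$. Let $X$ be the Zariski closure of $S$ in $\mathbb{R}^n$, let $\widetilde X\subset\mathbb{C}^n$ be the smallest complex algebraic set containing $X$, and let $\operatorname{Sing}(\widetilde X)$ be the set of points of $\widetilde X$ near which $\widetilde X$ is not a complex submanifold of $\mathbb{C}^n$. Put $\operatorname{Reg}(X):=X\setminus\operatorname{Sing}(\widetilde X)$ and let $\operatorname{Reg}(S)$ be the interior of $S\setminus\operatorname{Sing}(\widetilde X)$ in $\operatorname{Reg}(X)$. Let $S_1,\ldots,S_r$ be connected (non-empty) semialgebraic sets of dimension $d$ that are open subsets of $\operatorname{Reg}(S)$, and assume $\bigcup_{i=1}^r S_i\subset S\subset\operatorname{Cl}\big(\bigcup_{i=1}^r S_i\big)$; if $d=0$, assume in addition that the $S_i$ are pairwise different. Suppose that $S$ is connected by analytic paths, that is, for all $x,y\in S$ there is an analytic path $\alpha:[0,1]\to S$ with $\alpha(0)=x$ and $\alpha(1)=y$. A map defined on a semialgebraic subset $A$ of a real affine space is called Nash if it extends to a smooth map with semialgebraic graph on an open semialgebraic neighborhood of $A$. A Nash bridge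 between $S_i$ and $S_j$ is the image $\Gamma=\alpha([-1,1])$ of a Nash arc (an injective Nash map) $\alpha:[-1,1]\to\mathbb{R}^n$ with $\alpha([-1,0))\subset S_i$ and $\alpha((0,1])\subset S_j$; it is inside $S$ if $\Gamma\subset S$. Let $\Lambda$ be the graph with vertices $S_1,\ldots,S_r$ (one vertex for each index $i=1,\ldots,r$, even if some of the sets coincide) in which two different vertices $S_i$, $S_j$ are joined by an edge if and only if there is a Nash bridge inside $S$ between $S_i$ and $S_j$. Then the graph $\Lambda$ is connected. -/

import Mathlib

open scoped Topology ContDiff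

/-- Semialgebraic subsets of the real affine space with coordinates indexed by `ι`: finite boolean
combinations of polynomial equalities and inequalities. -/
inductive IsSemialgebraic {ι : Type} : Set (ι → ℝ) → Prop
  | eq_zero (p : MvPolynomial ι ℝ) : IsSemialgebraic {x | MvPolynomial.eval x p = 0}
  | pos (p : MvPolynomial ι ℝ) : IsSemialgebraic {x | 0 < MvPolynomial.eval x p}
  | compl {A : Set (ι → ℝ)} : IsSemialgebraic A → IsSemialgebraic Aᶜ
  | inter {A B : Set (ι → ℝ)} : IsSemialgebraic A → IsSemialgebraic B → IsSemialgebraic (A ∩ B)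
  | union {A B : Set (ι → ℝ)} : IsSemialgebraic A → IsSemialgebraic B → IsSemialgebraic (A ∪ B)

/-- The graph of `F` restricted to `A`, as a subset of the affine space with coordinates indexed
by `ι ⊕ κ`. -/
def graphOver {ι κ : Type} (F : (ι → ℝ) → (κ → ℝ)) (A : Set (ι → ℝ)) : Set (ι ⊕ κ → ℝ) :=
  {z | (fun i => z (Sum.inl i)) ∈ A ∧ (fun k => z (Sum.inr k)) = F (fun i => z (Sum.inl i))}

/-- `f` is a Nash map on the (semialgebraic) set `A`: it extends to a smooth map with semialgebraic
graph on some open semialgebraic neighbourhood of `A`. -/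
def IsNashOn {ι κ : Type} [Fintype ι] [Fintype κ] (f : (ι → ℝ) → (κ → ℝ)) (A : Set (ι → ℝ)) :
    Prop :=
  ∃ (U : Set (ι → ℝ)) (F : (ι → ℝ) → (κ → ℝ)), IsOpen U ∧ IsSemialgebraic U ∧ A ⊆ U ∧
    IsSemialgebraic (graphOver F U) ∧ ContDiffOn ℝ ∞ F U ∧ Set.EqOn f F A

/-- The dimension of a semialgebraic set: the Krull dimension of its ring of polynomial functions,
that is, the dimension of its Zariski closure. The empty set has dimension `⊥`. -/
noncomputable def semialgDim {n : ℕ} (A : Set (Fin n → ℝ)) : WithBot ℕ∞ :=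
  ringKrullDim (MvPolynomial (Fin n) ℝ ⧸ MvPolynomial.vanishingIdeal ℝ A)

/-- The Zariski closure of a subset of `k ^ n`: the smallest algebraic subset containing it. -/
def zariskiClosure {k : Type} [Field k] {n : ℕ} (A : Set (Fin n → k)) : Set (Fin n → k) :=
  MvPolynomial.zeroLocus k (MvPolynomial.vanishingIdeal k A)

/-- The complexification of a subset `X` of `ℝ ^ n`: the smallest complex algebraic subset of
`ℂ ^ n` that contains `X`. -/
def complexification {n : ℕ} (X : Set (Fin n → ℝ)) : Set (Fin n → ℂ) :=
  zariskiClosure ((fun x i => (x i : ℂ)) '' X)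

/-- `Z` is, near its point `z`, a complex submanifold of `ℂ ^ n`: some biholomorphism `φ` between
an open neighbourhood of `z` and an open subset of `ℂ ^ n` maps `Z` onto a linear subspace. -/
def IsComplexSmoothAt {n : ℕ} (Z : Set (Fin n → ℂ)) (z : Fin n → ℂ) : Prop :=
  ∃ (φ : OpenPartialHomeomorph (Fin n → ℂ) (Fin n → ℂ)) (V : Submodule ℂ (Fin n → ℂ)),
    z ∈ φ.source ∧ AnalyticOnNhd ℂ φ φ.source ∧ AnalyticOnNhd ℂ φ.symm φ.target ∧
      φ '' (φ.source ∩ Z) = φ.target ∩ (V : Set (Fin n → ℂ))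

/-- The singular points of a complex algebraic set. -/
def complexSing {n : ℕ} (Z : Set (Fin n → ℂ)) : Set (Fin n → ℂ) :=
  {z | z ∈ Z ∧ ¬ IsComplexSmoothAt Z z}

/-- The regular points of a real algebraic set `X`: those that are not singular points of its
complexification. -/
def algebraicReg {n : ℕ} (X : Set (Fin n → ℝ)) : Set (Fin n → ℝ) :=
  {x | x ∈ X ∧ (fun i => (x i : ℂ)) ∉ complexSing (complexification X)}

/-- The regular points of a semialgebraic set `S` with Zariski closure `X`: the interior of
`S ∩ Reg X` in `Reg X`. -/
def semialgReg {n : ℕ} (S : Set (Fin n → ℝ)) : Set (Fin n → ℝ) :=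
  {x | x ∈ algebraicReg (zariskiClosure S) ∧ S ∈ 𝓝[algebraicReg (zariskiClosure S)] x}

/-- Any two points of `S` are joined by a path `[0, 1] → S` that is analytic, also at the
end points (that is, on a neighbourhood of `[0, 1]`). -/
def ConnectedByAnalyticPaths {n : ℕ} (S : Set (Fin n → ℝ)) : Prop :=
  ∀ x ∈ S, ∀ y ∈ S, ∃ α : ℝ → Fin n → ℝ, AnalyticOnNhd ℝ α (Set.Icc 0 1) ∧
    Set.MapsTo α (Set.Icc 0 1) S ∧ α 0 = x ∧ α 1 = y

/-- `α` restricts to a Nash arc on `[-1, 1]`: an injective Nash map. -/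
def IsNashArc {n : ℕ} (α : ℝ → Fin n → ℝ) : Prop :=
  IsNashOn (fun t : Fin 1 → ℝ => α (t 0)) {t | t 0 ∈ Set.Icc (-1) 1} ∧
    Set.InjOn α (Set.Icc (-1) 1)

/-- `Γ` is a Nash bridge between `M` and `N`. -/
def IsNashBridge {n : ℕ} (M N Γ : Set (Fin n → ℝ)) : Prop :=
  ∃ α : ℝ → Fin n → ℝ, IsNashArc α ∧ Set.MapsTo α (Set.Ico (-1) 0) M ∧
    Set.MapsTo α (Set.Ioc 0 1) N ∧ Γ = α '' Set.Icc (-1) 1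

/-- The graph with vertices `1, …, r`, standing for the sets `T 1, …, T r`; distinct vertices
`i`, `j` are joined by an edge when there is a Nash bridge inside `S` between `T i` and `T j`. -/
def bridgeGraph {n r : ℕ} (S : Set (Fin n → ℝ)) (T : Fin r → Set (Fin n → ℝ)) :
    SimpleGraph (Fin r) :=
  SimpleGraph.fromRel fun i j => ∃ Γ ⊆ S, IsNashBridge (T i) (T j) Γ

/-!
An analytic path in `S` with generic end points runs, except at finitely many times, in the sets
`T k`. At an exceptional time it passes from one `T k` to another one, and it can be replaced there
by a Nash arc that does the same.

*Generic points.* Because `T i` has the dimension of `S`, its vanishing ideal lies in a minimal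
prime `P` of the vanishing ideal of `S` (`exists_minimalPrime_of_ringKrullDim_eq`), that is, `T i`
is Zariski dense in a component of the Zariski closure of `S`. There is a polynomial `g` outside `P`
such that every `T k` is, as a subset of `S`, locally constant at the points of `S` with `g ≠ 0`
(`exists_generic_polynomial`): a polynomial in the description of `T k` either vanishes on the
component or is made nonzero, and so of locally constant sign, by `g`. By density, the points of `S`
with `g ≠ 0` lie in some `T k`. Take an analytic path `α` in `S` from such a point of `T i` to a
generic point of `T j`. As `g` does not vanish at `α 0`, it vanishes at finitely many points of the
path only, hence every one-sided germ of the path runs in some `T k` (`reachable_of_path`). It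
remains to show that two sets `T k`, `T l` in which the path runs directly before and after a time
`t` are joined by a Nash bridge; connectedness of `[0, 1]` then joins `i` to `j`.

*Analytic arcs and Nash arcs.* Let `α` be an analytic arc. The coordinates of `α` can be
approximated to any order by analytic germs that are algebraic over the polynomials and satisfy all
the polynomial relations between the coordinates of `α` (`exists_algebraic_approx`). This is the
one-variable case of Artin approximation. It is proved one coordinate at a time: a transcendental
coordinate is replaced by a Taylor polynomial, an algebraic one by a root, near the old one, of its
minimal equation with perturbed coefficients, which exists by Newton's lemma
(`exists_root_of_approx_root`). A polynomial that does not vanish identically on the arc keeps its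
signs if the order of approximation is high, so the new arc lies in the same semialgebraic sets as
`α`, on both sides of the origin (`IsSemialgebraic.exists_order`). The new arc is Nash: its graph is
semialgebraic because, by Thom's lemma, a root of a polynomial is singled out by the signs of the
derivatives at it (`eventually_isNashOn_arc`). It is injective near the origin if its two halves run
in disjoint sets, or if its derivative there is nonzero (`exists_nashBridge`). If `α` comes from
`T k` and goes on in `T l`, then either it goes on in `T l \ T k`, which is disjoint from `T k`, or
it runs in both sets for a while, and a point with nonzero derivative can be used.

*Dimension zero.* A nonconstant analytic path in `S` would give a prime ideal that is not maximal
and contains the vanishing ideal of `S`. So `S` is a point, all `T i` are equal to it, and there is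
one vertex only.
-/

section

open Polynomial Filter

/-! ### Germs of analytic functions of one real variable -/

/-- The real functions of one variable that are analytic at the origin. -/
def analyticFun : Subalgebra ℝ (ℝ → ℝ) where
  carrier := {f | AnalyticAt ℝ f 0}
  mul_mem' hf hg := AnalyticAt.mul hf hg
  add_mem' hf hg := AnalyticAt.add hf hg
  algebraMap_mem' _ := analyticAt_const

/-- The analytic functions whose germ at the origin is zero. -/
def zeroGermIdeal : Ideal analyticFun where
  carrier := {f | ∀ᶠ s in 𝓝 0, (f : ℝ → ℝ) s = 0}
  zero_mem' := Eventually.of_forall fun _ => rfl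
  add_mem' {f g} hf hg := by
    filter_upwards [hf, hg] with s h1 h2
    simp [h1, h2]
  smul_mem' f g hg := by
    filter_upwards [hg] with s h
    simp [h]

/-- The ring of germs at the origin of real analytic functions of one variable. -/
abbrev AGerm : Type := analyticFun ⧸ zeroGermIdeal

noncomputable instance : CommRing AGerm := Ideal.Quotient.commRing _

/-- The germ of an analytic function. -/
abbrev germ (f : analyticFun) : AGerm := Ideal.Quotient.mk zeroGermIdeal f

theorem germ_surjective (a : AGerm) : ∃ f, germ f = a := Ideal.Quotient.mk_surjective a

theorem germ_eq_zero {f : analyticFun} : germ f = 0 ↔ ∀ᶠ s in 𝓝 0, (f : ℝ → ℝ) s = 0 :=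
  Ideal.Quotient.eq_zero_iff_mem

theorem germ_eq_germ {f g : analyticFun} :
    germ f = germ g ↔ ∀ᶠ s in 𝓝 0, (f : ℝ → ℝ) s = (g : ℝ → ℝ) s := by
  rw [← sub_eq_zero, ← map_sub, germ_eq_zero]
  simp [sub_eq_zero]

instance : zeroGermIdeal.IsPrime where
  ne_top' := by
    rw [Ne, Ideal.eq_top_iff_one]
    intro h
    exact one_ne_zero (α := ℝ) h.self_of_nhds
  mem_or_mem' {f g} h := by
    rcases f.2.eventually_eq_zero_or_eventually_ne_zero with hf | hf
    · exact Or.inl hf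
    rcases g.2.eventually_eq_zero_or_eventually_ne_zero with hg | hg
    · exact Or.inr hg
    obtain ⟨s, h0, h1, h2⟩ :=
      ((Eventually.filter_mono nhdsWithin_le_nhds h).and (hf.and hg)).exists
    exact absurd h0 (mul_ne_zero h1 h2)

instance : IsDomain AGerm := Ideal.Quotient.isDomain _

/-- The identity function, as an analytic function. -/
def idFun : analyticFun := ⟨id, analyticAt_id⟩

/-- The germ of the identity function, a uniformizer of the ring of analytic germs. -/
abbrev unif : AGerm := germ idFun

theorem isUnit_germ {f : analyticFun} (h : (f : ℝ → ℝ) 0 ≠ 0) : IsUnit (germ f) := by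
  refine isUnit_iff_exists_inv.2 ⟨germ ⟨fun s => ((f : ℝ → ℝ) s)⁻¹, f.2.inv h⟩, ?_⟩
  rw [← map_mul, ← map_one (Ideal.Quotient.mk zeroGermIdeal), germ_eq_germ]
  filter_upwards [f.2.continuousAt.eventually_ne h] with s hs
  exact mul_inv_cancel₀ hs

theorem eq_unif_pow_mul_unit {a : AGerm} (ha : a ≠ 0) :
    ∃ (e : ℕ) (g : analyticFun), (g : ℝ → ℝ) 0 ≠ 0 ∧ a = unif ^ e * germ g := by
  obtain ⟨f, rfl⟩ := germ_surjective a
  obtain ⟨e, g, hg, hg0, h⟩ := (f.2.exists_eventuallyEq_pow_smul_nonzero_iff).2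
    (fun h => ha (germ_eq_zero.2 h))
  refine ⟨e, ⟨g, hg⟩, hg0, ?_⟩
  rw [← map_pow, ← map_mul, germ_eq_germ]
  filter_upwards [h] with s hs
  rw [hs]
  simp [idFun]

theorem unif_ne_zero : unif ≠ 0 := by
  intro h
  have h1 : ∀ᶠ s in 𝓝[≠] (0 : ℝ), s = 0 :=
    (germ_eq_zero.1 h).filter_mono nhdsWithin_le_nhds
  obtain ⟨s, h1, h2⟩ := (h1.and self_mem_nhdsWithin).exists
  exact h2 h1

theorem apply_zero_of_unif_dvd {f : analyticFun} (h : unif ∣ germ f) : (f : ℝ → ℝ) 0 = 0 := by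
  obtain ⟨b, hb⟩ := h
  obtain ⟨g, rfl⟩ := germ_surjective b
  rw [← map_mul, germ_eq_germ] at hb
  simpa [idFun] using hb.self_of_nhds

theorem unif_dvd_iff {f : analyticFun} : unif ∣ germ f ↔ (f : ℝ → ℝ) 0 = 0 := by
  refine ⟨apply_zero_of_unif_dvd, fun h => ?_⟩
  by_cases hf : germ f = 0
  · simp [hf]
  obtain ⟨e, g, hg0, he⟩ := eq_unif_pow_mul_unit hf
  rw [he]
  refine Dvd.dvd.mul_right (dvd_pow_self _ ?_) _
  rintro rfl
  rw [pow_zero, one_mul, germ_eq_germ] at he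
  exact hg0 (he.self_of_nhds ▸ h)

theorem exists_unif_dvd_sub_const (a : AGerm) : ∃ c : ℝ, unif ∣ a - algebraMap ℝ AGerm c := by
  obtain ⟨f, rfl⟩ := germ_surjective a
  refine ⟨(f : ℝ → ℝ) 0, ?_⟩
  have : germ f - algebraMap ℝ AGerm ((f : ℝ → ℝ) 0)
      = germ (f - algebraMap ℝ analyticFun ((f : ℝ → ℝ) 0)) := by
    exact (map_sub (Ideal.Quotient.mk zeroGermIdeal) f _).symm
  rw [this, unif_dvd_iff]
  simp [Algebra.algebraMap_eq_smul_one]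

theorem isUnit_of_not_unif_dvd {a : AGerm} (h : ¬ unif ∣ a) : IsUnit a := by
  obtain ⟨f, rfl⟩ := germ_surjective a
  exact isUnit_germ (fun h0 => h (unif_dvd_iff.2 h0))

theorem not_unif_dvd_of_isUnit {a : AGerm} (h : IsUnit a) : ¬ unif ∣ a := by
  intro h'
  have h1 : unif ∣ germ 1 := (h'.trans (h.dvd (a := 1)))
  have := unif_dvd_iff.1 h1
  simp at this

/-- Taylor expansion: a germ is congruent to a polynomial modulo any power of the uniformizer. -/
theorem exists_unif_pow_dvd_sub_aeval (M : ℕ) (a : AGerm) :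
    ∃ q : ℝ[X], unif ^ M ∣ a - aeval unif q := by
  induction M generalizing a with
  | zero => exact ⟨0, by simp⟩
  | succ M ih =>
    obtain ⟨c, b, hb⟩ := exists_unif_dvd_sub_const a
    obtain ⟨q, d, hd⟩ := ih b
    refine ⟨C c + X * q, d, ?_⟩
    rw [map_add, aeval_C, map_mul, aeval_X]
    linear_combination hb + unif * hd

/-- The ring of analytic germs is henselian: simple roots modulo the uniformizer lift, by the
analytic implicit function theorem. -/
theorem exists_root_of_simple_root (G : AGerm[X]) (h0 : unif ∣ G.eval 0)
    (h1 : IsUnit (G.derivative.eval 0)) : ∃ w, G.eval w = 0 ∧ unif ∣ w := by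
  obtain ⟨H, rfl⟩ := Polynomial.map_surjective (Ideal.Quotient.mk zeroGermIdeal)
    Ideal.Quotient.mk_surjective G
  have hev : ∀ f : analyticFun, (H.map (Ideal.Quotient.mk zeroGermIdeal)).eval (germ f)
      = germ (H.eval f) := fun f => by rw [Polynomial.eval_map, Polynomial.eval₂_at_apply]
  -- the function of two variables defined by the polynomial
  set Φ : ℝ × ℝ → ℝ := fun z => ∑ k ∈ H.support, (H.coeff k : ℝ → ℝ) z.1 * z.2 ^ k with hΦ
  have hΦev : ∀ (f : analyticFun) (s : ℝ), ((H.eval f : analyticFun) : ℝ → ℝ) s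
      = Φ (s, (f : ℝ → ℝ) s) := fun f s => by
    rw [Polynomial.eval_eq_sum, Polynomial.sum]
    simp [hΦ, Finset.sum_apply]
  have hder : ∀ s w : ℝ, HasDerivAt (fun w => Φ (s, w))
      (∑ k ∈ H.support, (H.coeff k : ℝ → ℝ) s * (k * w ^ (k - 1))) w := fun s w =>
    HasDerivAt.fun_sum fun k _ => (hasDerivAt_pow k w).const_mul ((H.coeff k : ℝ → ℝ) s)
  have hΦ0 : Φ (0, 0) = 0 := by
    have : germ (0 : analyticFun) = 0 := map_zero _
    rw [← this, hev] at h0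
    simpa [hΦev] using unif_dvd_iff.1 h0
  have hder0 : (∑ k ∈ H.support, (H.coeff k : ℝ → ℝ) 0 * (k * (0 : ℝ) ^ (k - 1))) ≠ 0 := by
    intro h
    refine not_unif_dvd_of_isUnit h1 ?_
    have e : (H.map (Ideal.Quotient.mk zeroGermIdeal)).derivative.eval 0
        = germ (H.derivative.eval 0) := by
      rw [Polynomial.derivative_map, ← map_zero (Ideal.Quotient.mk zeroGermIdeal),
        Polynomial.eval_map, Polynomial.eval₂_at_apply]
    rw [e, unif_dvd_iff, Polynomial.derivative_eval, Polynomial.sum]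
    simpa [Finset.sum_apply, mul_assoc] using h
  have hcd : ContDiffAt ℝ ω Φ (0, 0) := by
    refine AnalyticAt.contDiffAt ?_
    refine Finset.analyticAt_fun_sum _ fun k _ => ?_
    refine AnalyticAt.mul ?_ (analyticAt_snd.pow k)
    exact AnalyticAt.fun_comp (g := (H.coeff k : ℝ → ℝ)) (f := Prod.fst) (x := ((0 : ℝ), (0 : ℝ)))
      (H.coeff k).2 analyticAt_fst
  have hfd : fderiv ℝ Φ (0, 0) ∘L .inr ℝ ℝ ℝ = ContinuousLinearMap.toSpanSingleton ℝ
      (∑ k ∈ H.support, (H.coeff k : ℝ → ℝ) 0 * (k * (0 : ℝ) ^ (k - 1))) := by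
    have hd : HasFDerivAt Φ (fderiv ℝ Φ (0, 0)) ((0 : ℝ), (0 : ℝ)) :=
      (hcd.differentiableAt (by simp)).hasFDerivAt
    have h2 : HasFDerivAt (fun w : ℝ => ((0 : ℝ), w)) (.inr ℝ ℝ ℝ) 0 :=
      hasFDerivAt_prodMk_right 0 0
    exact (hd.comp (0 : ℝ) h2).unique (hder 0 0).hasFDerivAt
  have hinv : (fderiv ℝ Φ (0, 0) ∘L .inr ℝ ℝ ℝ).IsInvertible := by
    rw [hfd]
    refine ⟨ContinuousLinearEquiv.unitsEquivAut ℝ (Units.mk0 _ hder0), ?_⟩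
    ext
    simp
  have hψ := (hcd.contDiffAt_implicitFunction (by simp) hinv)
  refine ⟨germ ⟨_, hψ.analyticAt⟩, ?_, ?_⟩
  · rw [hev, germ_eq_zero]
    filter_upwards [hcd.eventually_apply_implicitFunction (by simp) hinv] with s hs
    rw [hΦev]
    exact hs.trans hΦ0
  · rw [unif_dvd_iff]
    exact hcd.implicitFunction_apply_self (by simp) hinv

/-! ### Approximation of analytic germs by algebraic germs -/

/-- Newton's lemma for analytic germs: an approximate root `y` at which the derivative has order `e`
can be corrected to a root, once the error has order more than `2 * e`. -/
theorem exists_root_of_approx_root (F : AGerm[X]) (y u : AGerm) (hu : IsUnit u) (e K : ℕ)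
    (hder : F.derivative.eval y = unif ^ e * u)
    (hF : unif ^ (2 * e + K + 1) ∣ F.eval y) :
    ∃ y', F.eval y' = 0 ∧ unif ^ (e + K) ∣ y' - y := by
  obtain ⟨a, ha⟩ := hF
  set Q := (taylor y F).divX.divX with hQ
  have hT : taylor y F = (Q * X + C (unif ^ e * u)) * X + C (unif ^ (2 * e + K + 1) * a) := by
    have h1 := (divX_mul_X_add (taylor y F)).symm
    have h2 := (divX_mul_X_add (taylor y F).divX).symm
    rw [coeff_divX, zero_add, taylor_coeff_one, hder] at h2
    rw [taylor_coeff_zero, ha, h2] at h1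
    exact h1
  -- the equation for the correction, rescaled by the power of the uniformizer it is divisible by
  set G : AGerm[X] := C (unif * a) + C u * X
    + X ^ 2 * (C (unif ^ K) * Q.comp (C (unif ^ (e + K)) * X)) with hG
  obtain ⟨w, hw, -⟩ := exists_root_of_simple_root G (by simp [hG]) (by simpa [hG] using hu)
  refine ⟨unif ^ (e + K) * w + y, ?_, by simp⟩
  have h3 : F.eval (unif ^ (e + K) * w + y) = unif ^ (2 * e + K) * G.eval w := by
    rw [← taylor_eval, hT, hG]
    simp only [eval_add, eval_mul, eval_C, eval_X, eval_pow, eval_comp]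
    ring
  rw [h3, hw, mul_zero]

instance : CharZero AGerm := charZero_of_injective_algebraMap (algebraMap ℝ AGerm).injective

/-- Analytic germs as an algebra over the polynomials in the uniformizer; the algebraic elements are
the germs of Nash functions. -/
noncomputable instance : Algebra ℝ[X] AGerm := (aeval unif : ℝ[X] →ₐ[ℝ] AGerm).toRingHom.toAlgebra

theorem algebraMap_polynomial (q : ℝ[X]) : algebraMap ℝ[X] AGerm q = aeval unif q := rfl

theorem isAlgebraic_of_eval₂_eq_zero {R₀ R A : Type*} [CommRing R₀] [IsDomain R₀] [CommRing R]
    [CommRing A] [IsDomain A] [Algebra R₀ A] {ψ : R →+* A} (halg : ∀ r, IsAlgebraic R₀ (ψ r))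
    {F : R[X]} (hl : ψ F.leadingCoeff ≠ 0) {y : A} (h : F.eval₂ ψ y = 0) : IsAlgebraic R₀ y := by
  let ψ' : R →+* Subalgebra.algebraicClosure R₀ A := ψ.codRestrict _ halg
  have : IsAlgebraic (Subalgebra.algebraicClosure R₀ A) y := by
    refine ⟨F.map ψ', fun h0 => hl ?_, ?_⟩
    · have h1 := congrArg (fun P => coeff P F.natDegree) h0
      simp only [coeff_map, coeff_zero] at h1
      exact congrArg Subtype.val h1
    · rw [aeval_def, eval₂_map]
      exact h
  exact this.restrictScalars R₀

theorem ne_zero_of_close {a b : AGerm} {e N : ℕ} {u : AGerm} (hu : IsUnit u)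
    (ha : a = unif ^ e * u) (h : unif ^ N ∣ b - a) (hN : e < N) : b ≠ 0 := by
  rintro rfl
  rw [zero_sub, dvd_neg, ha] at h
  obtain ⟨c, hc⟩ := h
  obtain ⟨k, rfl⟩ := Nat.exists_eq_add_of_lt hN
  refine not_unif_dvd_of_isUnit hu ⟨unif ^ k * c, ?_⟩
  refine mul_left_cancel₀ (pow_ne_zero e unif_ne_zero) ?_
  rw [hc]
  ring

theorem unif_pow_dvd_eval₂_sub {R : Type*} [CommRing R] {φ ψ : R →+* AGerm} {N : ℕ}
    (h : ∀ r, unif ^ N ∣ ψ r - φ r) (y : AGerm) (F : R[X]) :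
    unif ^ N ∣ F.eval₂ ψ y - F.eval₂ φ y := by
  rw [eval₂_eq_sum, eval₂_eq_sum, Polynomial.sum, Polynomial.sum, ← Finset.sum_sub_distrib]
  refine Finset.dvd_sum fun k _ => ?_
  rw [← sub_mul]
  exact (h _).mul_right _

/-- Suppose that the leading coefficient of every polynomial of degree less than `D` with the root
`y` is mapped to zero by `φ`. Then all coefficients of such polynomials are. -/
theorem coeff_eq_zero_of_minimal {R : Type*} [CommRing R] (φ : R →+* AGerm) (y : AGerm) (D : ℕ)
    (hD : ∀ F : R[X], F.natDegree < D → F.eval₂ φ y = 0 → φ F.leadingCoeff = 0)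
    (g : R[X]) (hg : g.natDegree < D) (h0 : g.eval₂ φ y = 0) (k : ℕ) : φ (g.coeff k) = 0 := by
  induction hm : g.support.card generalizing g with
  | zero =>
    have : g = 0 := by simpa using hm
    simp [this]
  | succ m ih =>
    have hl := hD g hg h0
    have he : g.eraseLead.eval₂ φ y = 0 := by
      have h1 := congrArg (eval₂ φ y) g.eraseLead_add_C_mul_X_pow
      rw [eval₂_add, eval₂_mul, eval₂_C, hl, zero_mul, add_zero, h0] at h1
      exact h1
    have := ih g.eraseLead (eraseLead_natDegree_le_aux.trans_lt hg) he
      (card_support_eraseLead' hm)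
    by_cases hk : k = g.natDegree
    · rw [hk]; exact hl
    · rwa [eraseLead_coeff_of_ne _ hk] at this

theorem eval₂_eq_zero_of_coeff {R : Type*} [CommRing R] {φ ψ : R →+* AGerm}
    (hker : ∀ r, φ r = 0 → ψ r = 0) {g : R[X]} (hg : ∀ k, φ (g.coeff k) = 0) (y : AGerm) :
    g.eval₂ ψ y = 0 := by
  rw [eval₂_eq_sum, Polynomial.sum]
  exact Finset.sum_eq_zero fun k _ => by rw [hker _ (hg k), zero_mul]

/-- One more germ: an approximation `ψ` by algebraic germs of the homomorphism `φ` that preserves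
all relations extends to a further germ `y`. If `y` is transcendental a Taylor polynomial will
do; otherwise the minimal equation of `y` is solved over `ψ` by Newton's lemma. -/
theorem exists_algebraic_extension {R : Type*} [CommRing R] (φ : R →+* AGerm) (y : AGerm) (M : ℕ) :
    ∃ N, ∀ ψ : R →+* AGerm, (∀ r, φ r = 0 → ψ r = 0) → (∀ r, unif ^ N ∣ ψ r - φ r) →
      (∀ r, IsAlgebraic ℝ[X] (ψ r)) →
      ∃ y', IsAlgebraic ℝ[X] y' ∧ unif ^ M ∣ y' - y ∧
        ∀ g : R[X], g.eval₂ φ y = 0 → g.eval₂ ψ y' = 0 := by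
  classical
  by_cases h : ∃ (d : ℕ) (F : R[X]), F.natDegree = d ∧ F.eval₂ φ y = 0 ∧ φ F.leadingCoeff ≠ 0
  swap
  · refine ⟨0, fun ψ hker _ _ => ?_⟩
    obtain ⟨q, hq⟩ := exists_unif_pow_dvd_sub_aeval M y
    refine ⟨aeval unif q, isAlgebraic_algebraMap q, (dvd_sub_comm).1 hq,
      fun g hg => eval₂_eq_zero_of_coeff hker (fun k => ?_) _⟩
    refine coeff_eq_zero_of_minimal φ y (g.natDegree + 1) (fun F _ hF => ?_) g
      (Nat.lt_succ_self _) hg k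
    by_contra hne
    exact h ⟨_, F, rfl, hF, hne⟩
  obtain ⟨F, hFd, hF0, hFl⟩ := Nat.find_spec h
  have hmin : ∀ G : R[X], G.natDegree < F.natDegree → G.eval₂ φ y = 0 →
      φ G.leadingCoeff = 0 := fun G hG hG0 => by
    by_contra hne
    exact Nat.find_min h (hFd ▸ hG) ⟨G, rfl, hG0, hne⟩
  have hd : F.natDegree ≠ 0 := fun h0 => by
    rw [eq_C_of_natDegree_eq_zero h0, eval₂_C] at hF0
    rw [leadingCoeff, h0] at hFl
    exact hFl hF0
  -- the root `y` of the minimal equation is simple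
  have hder : F.derivative.eval₂ φ y ≠ 0 := fun h0 => by
    have := coeff_eq_zero_of_minimal φ y _ hmin F.derivative (natDegree_derivative_lt hd) h0
      (F.natDegree - 1)
    rw [coeff_derivative, Nat.sub_add_cancel (Nat.one_le_iff_ne_zero.2 hd), map_mul] at this
    rcases mul_eq_zero.1 this with h1 | h1
    · exact hFl h1
    · rw [map_add, map_natCast, map_one] at h1
      exact Nat.cast_add_one_ne_zero _ h1
  obtain ⟨e, u, hu0, hu⟩ := eq_unif_pow_mul_unit hder
  obtain ⟨e', u', hu0', hu'⟩ := eq_unif_pow_mul_unit hFl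
  -- `2 * e + (M + 1) + 1` is what Newton's lemma needs; orders above `e'` keep the leading
  -- coefficient nonzero
  refine ⟨2 * e + (M + 1) + 1 + e', fun ψ hker hclose halg => ?_⟩
  have hψl : ψ F.leadingCoeff ≠ 0 :=
    ne_zero_of_close (isUnit_germ hu0') hu' (hclose _) (by omega)
  obtain ⟨v, hv⟩ := unif_pow_dvd_eval₂_sub hclose y F.derivative
  obtain ⟨y', hy'0, hy'⟩ := exists_root_of_approx_root (F.map ψ) y
    (germ u + unif * (unif ^ (e + (M + 1) + e') * v))
    (isUnit_of_not_unif_dvd fun hdvd => not_unif_dvd_of_isUnit (isUnit_germ hu0)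
      ((dvd_add_left (dvd_mul_right _ _)).1 hdvd)) e (M + 1)
    (by
      rw [derivative_map, eval_map]
      linear_combination hv + hu)
    (by
      have := unif_pow_dvd_eval₂_sub hclose y F
      rw [hF0, sub_zero] at this
      rw [eval_map]
      exact (pow_dvd_pow _ (by omega)).trans this)
  rw [eval_map] at hy'0
  refine ⟨y', ?_, (pow_dvd_pow _ (by omega)).trans hy', fun g => ?_⟩
  · exact isAlgebraic_of_eval₂_eq_zero halg hψl hy'0
  · induction hm : g.natDegree using Nat.strong_induction_on generalizing g with
    | _ m ih =>
      subst hm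
      intro hg
      by_cases hlt : g.natDegree < F.natDegree
      · exact eval₂_eq_zero_of_coeff hker
          (coeff_eq_zero_of_minimal φ y _ hmin g hlt hg) _
      -- one step of pseudo-division by the minimal equation
      set g₁ := C F.leadingCoeff * g - C g.leadingCoeff * X ^ (g.natDegree - F.natDegree) * F
        with hg₁
      have hdeg : g₁.natDegree < g.natDegree := by
        have hle : g₁.natDegree ≤ g.natDegree := by
          refine (natDegree_sub_le _ _).trans (max_le (natDegree_C_mul_le _ _) ?_)
          rw [mul_assoc]
          refine (natDegree_C_mul_le _ _).trans (natDegree_mul_le.trans ?_)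
          have := natDegree_X_pow_le (R := R) (g.natDegree - F.natDegree)
          omega
        refine lt_of_le_of_ne hle fun heq => ?_
        have hc : g₁.coeff g.natDegree = 0 := by
          have h2 : g.natDegree = F.natDegree + (g.natDegree - F.natDegree) := by omega
          rw [hg₁, coeff_sub, coeff_C_mul, mul_assoc, coeff_C_mul]
          nth_rw 3 [h2]
          rw [mul_comm (X ^ _) F, coeff_mul_X_pow, leadingCoeff, leadingCoeff]
          ring
        have h3 : g₁ = 0 := by
          rw [← leadingCoeff_eq_zero, leadingCoeff, heq, hc]
        rw [h3, natDegree_zero] at heq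
        omega
      have h4 : g₁.eval₂ ψ y' = 0 := ih _ hdeg g₁ rfl (by
        rw [hg₁, eval₂_sub, eval₂_mul, eval₂_mul, hg, hF0]
        ring)
      rw [hg₁, eval₂_sub, eval₂_mul, eval₂_mul _ _ (p := _ * _), hy'0, mul_zero, sub_zero,
        eval₂_C] at h4
      exact (mul_eq_zero.1 h4).resolve_left hψl

theorem aeval_cons_eq_eval₂ {n : ℕ} (y : AGerm) (a : Fin n → AGerm)
    (g : MvPolynomial (Fin (n + 1)) ℝ) :
    MvPolynomial.aeval (Fin.cons y a : Fin (n + 1) → AGerm) g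
      = (MvPolynomial.finSuccEquiv ℝ n g).eval₂
        (MvPolynomial.aeval a : MvPolynomial (Fin n) ℝ →ₐ[ℝ] AGerm).toRingHom y := by
  induction g using MvPolynomial.induction_on with
  | C c => simp [MvPolynomial.finSuccEquiv_apply]
  | add p q hp hq => simp only [map_add, eval₂_add, hp, hq]
  | mul_X p i hp =>
    rw [map_mul, map_mul, eval₂_mul, hp, MvPolynomial.aeval_X]
    congr 1
    refine Fin.cases ?_ (fun j => ?_) i
    · simp [MvPolynomial.finSuccEquiv_X_zero]
    · simp [MvPolynomial.finSuccEquiv_X_succ]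

theorem unif_pow_dvd_aeval_sub {n N : ℕ} {a b : Fin n → AGerm} (h : ∀ i, unif ^ N ∣ b i - a i)
    (g : MvPolynomial (Fin n) ℝ) :
    unif ^ N ∣ MvPolynomial.aeval b g - MvPolynomial.aeval a g := by
  induction g using MvPolynomial.induction_on with
  | C c => simp
  | add p q hp hq =>
    rw [map_add, map_add, add_sub_add_comm]
    exact hp.add hq
  | mul_X p i hp =>
    obtain ⟨c, hc⟩ := hp
    obtain ⟨d, hd⟩ := h i
    refine ⟨c * b i + MvPolynomial.aeval a p * d, ?_⟩
    rw [map_mul, map_mul, MvPolynomial.aeval_X, MvPolynomial.aeval_X]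
    linear_combination b i * hc + MvPolynomial.aeval a p * hd

/-- Analytic germs can be approximated to any order by algebraic germs that satisfy all their
polynomial relations. -/
theorem exists_algebraic_approx (n : ℕ) (a : Fin n → AGerm) (M : ℕ) :
    ∃ b : Fin n → AGerm, (∀ i, IsAlgebraic ℝ[X] (b i)) ∧ (∀ i, unif ^ M ∣ b i - a i) ∧
      ∀ g : MvPolynomial (Fin n) ℝ, MvPolynomial.aeval a g = 0 → MvPolynomial.aeval b g = 0 := by
  induction n generalizing M with
  | zero =>
    refine ⟨a, fun i => i.elim0, fun i => i.elim0, fun g h => h⟩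
  | succ n ih =>
    obtain ⟨N, hN⟩ := exists_algebraic_extension
      (MvPolynomial.aeval (Fin.tail a) : MvPolynomial (Fin n) ℝ →ₐ[ℝ] AGerm).toRingHom (a 0) M
    obtain ⟨b, hb1, hb2, hb3⟩ := ih (Fin.tail a) (max M N)
    obtain ⟨y', hy1, hy2, hy3⟩ := hN
      (MvPolynomial.aeval b : MvPolynomial (Fin n) ℝ →ₐ[ℝ] AGerm).toRingHom hb3
      (fun r => (pow_dvd_pow _ (le_max_right _ _)).trans (unif_pow_dvd_aeval_sub hb2 r))
      (fun r => by
        induction r using MvPolynomial.induction_on with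
        | C c =>
          have := isAlgebraic_algebraMap (R := ℝ[X]) (A := AGerm) (C c)
          rw [algebraMap_polynomial, aeval_C] at this
          simpa using this
        | add p q hp hq => simpa using hp.add hq
        | mul_X p i hp => simpa using hp.mul (hb1 i))
    refine ⟨Fin.cons y' b, ?_, ?_, fun g hg => ?_⟩
    · refine Fin.cases ?_ fun i => ?_
      · simpa using hy1
      · simpa using hb1 i
    · refine Fin.cases ?_ fun i => ?_
      · simpa using hy2
      · rw [Fin.cons_succ]
        exact (pow_dvd_pow _ (le_max_left _ _)).trans (hb2 i)
    · rw [aeval_cons_eq_eval₂]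
      refine hy3 _ ?_
      rw [← aeval_cons_eq_eval₂, Fin.cons_self_tail]
      exact hg

/-! ### Semialgebraic sets along analytic arcs -/

/-- The arc with analytic coordinates `f`. -/
def arc {n : ℕ} (f : Fin n → analyticFun) (s : ℝ) : Fin n → ℝ := fun i => (f i : ℝ → ℝ) s

theorem coe_aeval_apply {n : ℕ} (f : Fin n → analyticFun) (g : MvPolynomial (Fin n) ℝ) (s : ℝ) :
    ((MvPolynomial.aeval f g : analyticFun) : ℝ → ℝ) s = MvPolynomial.eval (arc f s) g := by
  induction g using MvPolynomial.induction_on with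
  | C c => simp [Algebra.algebraMap_eq_smul_one]
  | add p q hp hq => simp [hp, hq]
  | mul_X p i hp => simp [hp, arc]

theorem aeval_germ {n : ℕ} (f : Fin n → analyticFun) (g : MvPolynomial (Fin n) ℝ) :
    MvPolynomial.aeval (fun i => germ (f i)) g = germ (MvPolynomial.aeval f g) :=
  (MvPolynomial.comp_aeval_apply f (Ideal.Quotient.mkₐ ℝ zeroGermIdeal) g).symm

/-- An analytic function that agrees with `p` beyond the order of `p` has the sign of `p` near the
origin. -/
theorem eventually_mul_pos_of_close {p q : analyticFun} {g : analyticFun} {e N : ℕ}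
    (hg : (g : ℝ → ℝ) 0 ≠ 0) (hp : germ p = unif ^ e * germ g)
    (h : unif ^ N ∣ germ q - germ p) (hN : e < N) :
    ∀ᶠ s in 𝓝[≠] 0, 0 < (p : ℝ → ℝ) s * (q : ℝ → ℝ) s := by
  obtain ⟨k, rfl⟩ := Nat.exists_eq_add_of_lt hN
  obtain ⟨c, hc⟩ := h
  obtain ⟨c, rfl⟩ := germ_surjective c
  have hq : germ q = germ (idFun ^ e * (g + idFun * (idFun ^ k * c))) := by
    simp only [map_mul, map_add, map_pow]
    linear_combination hc + hp
  rw [← map_pow, ← map_mul] at hp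
  have hlim : ContinuousAt (fun s => (g : ℝ → ℝ) s * ((g : ℝ → ℝ) s + s * (s ^ k * (c : ℝ → ℝ) s)))
      0 := by
    have h1 := g.2.continuousAt
    have h2 := c.2.continuousAt
    fun_prop
  have hpos : ∀ᶠ s in 𝓝 0, 0 < (g : ℝ → ℝ) s * ((g : ℝ → ℝ) s + s * (s ^ k * (c : ℝ → ℝ) s)) := by
    refine hlim.eventually (lt_mem_nhds ?_)
    simpa using hg
  filter_upwards [hpos.filter_mono nhdsWithin_le_nhds,
    (germ_eq_germ.1 hp).filter_mono nhdsWithin_le_nhds,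
    (germ_eq_germ.1 hq).filter_mono nhdsWithin_le_nhds, self_mem_nhdsWithin] with s h1 h2 h3 h4
  have h5 : 0 < s ^ e * s ^ e := mul_self_pos.2 (pow_ne_zero _ h4)
  rw [h2, h3]
  have := mul_pos h5 h1
  simp only [idFun, MulMemClass.coe_mul, AddMemClass.coe_add, SubmonoidClass.coe_pow,
    Pi.mul_apply, Pi.add_apply, Pi.pow_apply, id]
  linarith

/-- The relations between the coordinates of an arc and a sufficiently high jet decide whether the
arc runs in a given semialgebraic set. -/
theorem IsSemialgebraic.exists_order {n : ℕ} {T : Set (Fin n → ℝ)} (hT : IsSemialgebraic T)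
    (f : Fin n → analyticFun) :
    ∃ M, ∀ f' : Fin n → analyticFun, (∀ i, unif ^ M ∣ germ (f' i) - germ (f i)) →
      (∀ g : MvPolynomial (Fin n) ℝ, MvPolynomial.aeval (fun i => germ (f i)) g = 0 →
        MvPolynomial.aeval (fun i => germ (f' i)) g = 0) →
      ∀ᶠ s in 𝓝[≠] 0, (arc f s ∈ T ↔ arc f' s ∈ T) := by
  have key : ∀ p : MvPolynomial (Fin n) ℝ,
      ∃ M, ∀ f' : Fin n → analyticFun, (∀ i, unif ^ M ∣ germ (f' i) - germ (f i)) →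
      (∀ g : MvPolynomial (Fin n) ℝ, MvPolynomial.aeval (fun i => germ (f i)) g = 0 →
        MvPolynomial.aeval (fun i => germ (f' i)) g = 0) →
      ∀ᶠ s in 𝓝[≠] 0, (MvPolynomial.eval (arc f s) p = 0 ∧ MvPolynomial.eval (arc f' s) p = 0) ∨
        0 < MvPolynomial.eval (arc f s) p * MvPolynomial.eval (arc f' s) p := by
    intro p
    by_cases hp : MvPolynomial.aeval (fun i => germ (f i)) p = 0
    · refine ⟨0, fun f' _ hrel => ?_⟩
      have hp' := hrel p hp
      rw [aeval_germ, germ_eq_zero] at hp hp'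
      filter_upwards [hp.filter_mono nhdsWithin_le_nhds, hp'.filter_mono nhdsWithin_le_nhds]
        with s h1 h2
      rw [coe_aeval_apply] at h1 h2
      exact Or.inl ⟨h1, h2⟩
    · rw [aeval_germ] at hp
      obtain ⟨e, g, hg, he⟩ := eq_unif_pow_mul_unit hp
      refine ⟨e + 1, fun f' hclose _ => ?_⟩
      have h1 := unif_pow_dvd_aeval_sub hclose p
      rw [aeval_germ, aeval_germ] at h1
      filter_upwards [eventually_mul_pos_of_close hg he h1 (Nat.lt_succ_self e)] with s hs
      rw [coe_aeval_apply, coe_aeval_apply] at hs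
      exact Or.inr hs
  have hmono : ∀ {M M' : ℕ} {f' : Fin n → analyticFun}, M ≤ M' →
      (∀ i, unif ^ M' ∣ germ (f' i) - germ (f i)) → ∀ i, unif ^ M ∣ germ (f' i) - germ (f i) :=
    fun hM h i => (pow_dvd_pow _ hM).trans (h i)
  induction hT with
  | eq_zero p =>
    obtain ⟨M, hM⟩ := key p
    refine ⟨M, fun f' h1 h2 => ?_⟩
    filter_upwards [hM f' h1 h2] with s hs
    rcases hs with hs | hs
    · simp [hs.1, hs.2]
    · simp [left_ne_zero_of_mul hs.ne', right_ne_zero_of_mul hs.ne']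
  | pos p =>
    obtain ⟨M, hM⟩ := key p
    refine ⟨M, fun f' h1 h2 => ?_⟩
    filter_upwards [hM f' h1 h2] with s hs
    rcases hs with hs | hs
    · simp [hs.1, hs.2]
    · exact pos_iff_pos_of_mul_pos hs
  | compl _ ih =>
    obtain ⟨M, hM⟩ := ih
    refine ⟨M, fun f' h1 h2 => ?_⟩
    filter_upwards [hM f' h1 h2] with s hs
    exact not_congr hs
  | inter _ _ ih₁ ih₂ =>
    obtain ⟨M₁, hM₁⟩ := ih₁
    obtain ⟨M₂, hM₂⟩ := ih₂
    refine ⟨max M₁ M₂, fun f' h1 h2 => ?_⟩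
    filter_upwards [hM₁ f' (hmono (le_max_left _ _) h1) h2,
      hM₂ f' (hmono (le_max_right _ _) h1) h2] with s hs hs'
    exact and_congr hs hs'
  | union _ _ ih₁ ih₂ =>
    obtain ⟨M₁, hM₁⟩ := ih₁
    obtain ⟨M₂, hM₂⟩ := ih₂
    refine ⟨max M₁ M₂, fun f' h1 h2 => ?_⟩
    filter_upwards [hM₁ f' (hmono (le_max_left _ _) h1) h2,
      hM₂ f' (hmono (le_max_right _ _) h1) h2] with s hs hs'
    exact or_congr hs hs'

theorem AnalyticAt.eventually_sign_eq_right {p : ℝ → ℝ} {s₀ : ℝ} (hp : AnalyticAt ℝ p s₀) :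
    ∃ σ, ∀ᶠ s in 𝓝[>] s₀, SignType.sign (p s) = σ := by
  by_cases h : ∀ᶠ s in 𝓝 s₀, p s = 0
  · exact ⟨0, (h.filter_mono nhdsWithin_le_nhds).mono fun s hs => by rw [hs, sign_zero]⟩
  obtain ⟨e, g, hg, hg0, he⟩ := (hp.exists_eventuallyEq_pow_smul_nonzero_iff).2 h
  refine ⟨SignType.sign (g s₀), ?_⟩
  have hs : ∀ᶠ s in 𝓝 s₀, SignType.sign (g s) = SignType.sign (g s₀) := by
    rcases lt_or_gt_of_ne hg0 with h0 | h0
    · filter_upwards [hg.continuousAt.eventually (gt_mem_nhds h0)] with s hs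
      rw [sign_neg hs, sign_neg h0]
    · filter_upwards [hg.continuousAt.eventually (lt_mem_nhds h0)] with s hs
      rw [sign_pos hs, sign_pos h0]
  filter_upwards [hs.filter_mono nhdsWithin_le_nhds, he.filter_mono nhdsWithin_le_nhds,
    self_mem_nhdsWithin] with s h1 h2 h3
  rw [h2, smul_eq_mul, sign_mul, sign_pos (pow_pos (sub_pos.2 h3) e), one_mul, h1]

theorem AnalyticAt.eventually_sign_eq_left {p : ℝ → ℝ} {s₀ : ℝ} (hp : AnalyticAt ℝ p s₀) :
    ∃ σ, ∀ᶠ s in 𝓝[<] s₀, SignType.sign (p s) = σ := by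
  have hp' : AnalyticAt ℝ (fun s => p (-s)) (-s₀) :=
    AnalyticAt.fun_comp (g := p) (by rwa [neg_neg]) analyticAt_id.fun_neg
  obtain ⟨σ, hσ⟩ := hp'.eventually_sign_eq_right
  refine ⟨σ, ?_⟩
  filter_upwards [(tendsto_neg_nhdsLT (a := s₀)).eventually hσ] with s hs
  rwa [neg_neg] at hs

/-- A semialgebraic set contains a germ of an arc, or avoids it, provided that polynomials have
constant signs along it. -/
theorem IsSemialgebraic.eventually_mem_or {n : ℕ} {T : Set (Fin n → ℝ)} (hT : IsSemialgebraic T)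
    {l : Filter ℝ} {α : ℝ → Fin n → ℝ}
    (hl : ∀ p : MvPolynomial (Fin n) ℝ,
      ∃ σ, ∀ᶠ s in l, SignType.sign (MvPolynomial.eval (α s) p) = σ) :
    (∀ᶠ s in l, α s ∈ T) ∨ ∀ᶠ s in l, α s ∉ T := by
  induction hT with
  | eq_zero p =>
    obtain ⟨σ, hσ⟩ := hl p
    by_cases h : σ = 0
    · exact Or.inl (hσ.mono fun s hs => sign_eq_zero_iff.1 (hs.trans h))
    · exact Or.inr (hσ.mono fun s hs h' => h (hs.symm.trans (sign_eq_zero_iff.2 h')))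
  | pos p =>
    obtain ⟨σ, hσ⟩ := hl p
    by_cases h : σ = 1
    · exact Or.inl (hσ.mono fun s hs => sign_eq_one_iff.1 (hs.trans h))
    · exact Or.inr (hσ.mono fun s hs h' => h (hs.symm.trans (sign_eq_one_iff.2 h')))
  | compl _ ih =>
    rcases ih with ih | ih
    · exact Or.inr (ih.mono fun s hs => not_not.2 hs)
    · exact Or.inl ih
  | inter _ _ ih₁ ih₂ =>
    rcases ih₁ with h₁ | h₁
    · rcases ih₂ with h₂ | h₂
      · exact Or.inl (h₁.and h₂)
      · exact Or.inr (h₂.mono fun s hs h => hs h.2)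
    · exact Or.inr (h₁.mono fun s hs h => hs h.1)
  | union _ _ ih₁ ih₂ =>
    rcases ih₁ with h₁ | h₁
    · exact Or.inl (h₁.mono fun s hs => Or.inl hs)
    · rcases ih₂ with h₂ | h₂
      · exact Or.inl (h₂.mono fun s hs => Or.inr hs)
      · exact Or.inr ((h₁.and h₂).mono fun s hs => not_or.2 hs)

theorem AnalyticAt.eval_mvPolynomial {n : ℕ} {α : ℝ → Fin n → ℝ} {s₀ : ℝ}
    (hα : AnalyticAt ℝ α s₀) (p : MvPolynomial (Fin n) ℝ) :
    AnalyticAt ℝ (fun s => MvPolynomial.eval (α s) p) s₀ := by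
  induction p using MvPolynomial.induction_on with
  | C c => simpa using analyticAt_const
  | add p q hp hq => simpa using hp.fun_add hq
  | mul_X p i hp => simpa using hp.fun_mul (analyticAt_pi_iff.1 hα i)

/-! ### Algebraic germs are Nash -/

theorem IsSemialgebraic.univ {ι : Type} : IsSemialgebraic (Set.univ : Set (ι → ℝ)) := by
  simpa using IsSemialgebraic.eq_zero (0 : MvPolynomial ι ℝ)

theorem IsSemialgebraic.biInter {ι κ : Type} (s : Finset κ) {A : κ → Set (ι → ℝ)}
    (h : ∀ k ∈ s, IsSemialgebraic (A k)) : IsSemialgebraic {x | ∀ k ∈ s, x ∈ A k} := by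
  classical
  induction s using Finset.induction_on with
  | empty => simpa using IsSemialgebraic.univ
  | insert k s _ ih =>
    simp only [Finset.forall_mem_insert]
    exact (h k (Finset.mem_insert_self _ _)).inter
      (ih fun j hj => h j (Finset.mem_insert_of_mem hj))

theorem IsSemialgebraic.sign_eq {ι : Type} (p : MvPolynomial ι ℝ) (σ : SignType) :
    IsSemialgebraic {x | SignType.sign (MvPolynomial.eval x p) = σ} := by
  rcases σ.trichotomy with rfl | rfl | rfl
  · simpa [sign_eq_neg_one_iff] using IsSemialgebraic.pos (-p)
  · simpa [sign_eq_zero_iff] using IsSemialgebraic.eq_zero p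
  · simpa [sign_eq_one_iff] using IsSemialgebraic.pos p

theorem IsSemialgebraic.preimage {ι κ : Type} {A : Set (ι → ℝ)} (hA : IsSemialgebraic A)
    (q : ι → MvPolynomial κ ℝ) :
    IsSemialgebraic {z : κ → ℝ | (fun i => MvPolynomial.eval z (q i)) ∈ A} := by
  have key : ∀ (p : MvPolynomial ι ℝ) (z : κ → ℝ),
      MvPolynomial.eval z (MvPolynomial.bind₁ q p)
        = MvPolynomial.eval (fun i => MvPolynomial.eval z (q i)) p := fun p z => by
    rw [MvPolynomial.eval, MvPolynomial.eval₂Hom_bind₁]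
    rfl
  induction hA with
  | eq_zero p => simpa [key] using IsSemialgebraic.eq_zero (MvPolynomial.bind₁ q p)
  | pos p => simpa [key] using IsSemialgebraic.pos (MvPolynomial.bind₁ q p)
  | compl _ ih => exact ih.compl
  | inter _ _ ih₁ ih₂ => exact ih₁.inter ih₂
  | union _ _ ih₁ ih₂ => exact ih₁.union ih₂

/-- Thom's lemma: if a polynomial and all its derivatives have the same signs at `x` and `y`, then
the polynomial has this sign on the whole interval. -/
theorem sign_eq_of_sign_derivatives_eq (P : ℝ[X]) {x y : ℝ}
    (h : ∀ k, SignType.sign ((derivative^[k] P).eval x)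
      = SignType.sign ((derivative^[k] P).eval y)) :
    ∀ z ∈ Set.Icc x y, SignType.sign (P.eval z) = SignType.sign (P.eval x) := by
  induction hd : P.natDegree using Nat.strong_induction_on generalizing P with
  | _ d ih =>
    intro z hz
    by_cases h0 : P.natDegree = 0
    · rw [eq_C_of_natDegree_eq_zero h0, eval_C, eval_C]
    have ih' := ih _ (hd ▸ natDegree_derivative_lt h0) (derivative P) (fun k => h (k + 1)) rfl
    have hx : x ∈ Set.Icc x y := ⟨le_rfl, hz.1.trans hz.2⟩
    have hy : y ∈ Set.Icc x y := ⟨hz.1.trans hz.2, le_rfl⟩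
    have hxy := h 0
    simp only [Function.iterate_zero, id] at hxy
    rcases le_total 0 ((derivative P).eval x) with h1 | h1
    · have hm : MonotoneOn (fun w => P.eval w) (Set.Icc x y) := by
        refine monotoneOn_of_deriv_nonneg (convex_Icc _ _) P.continuousOn P.differentiableOn
          fun w hw => ?_
        rw [Polynomial.deriv, ← sign_nonneg_iff, ih' w (interior_subset hw), sign_nonneg_iff]
        exact h1
      exact le_antisymm (hxy ▸ SignType.sign.monotone (hm hz hy hz.2))
        (SignType.sign.monotone (hm hx hz hz.1))
    · have hm : AntitoneOn (fun w => P.eval w) (Set.Icc x y) := by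
        refine antitoneOn_of_deriv_nonpos (convex_Icc _ _) P.continuousOn P.differentiableOn
          fun w hw => ?_
        rw [Polynomial.deriv, ← sign_nonpos_iff, ih' w (interior_subset hw), sign_nonpos_iff]
        exact h1
      exact le_antisymm (SignType.sign.monotone (hm hx hz hz.1))
        (hxy ▸ SignType.sign.monotone (hm hz hy hz.2))

/-- A root of a nonzero polynomial is determined by the signs of the derivatives at it. -/
theorem root_eq_of_sign_derivatives_eq {P : ℝ[X]} (hP : P ≠ 0) {x y : ℝ} (hx : P.eval x = 0)
    (h : ∀ k, SignType.sign ((derivative^[k] P).eval x)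
      = SignType.sign ((derivative^[k] P).eval y)) : x = y := by
  have key : ∀ {x y : ℝ}, P.eval x = 0 → (∀ k, SignType.sign ((derivative^[k] P).eval x)
      = SignType.sign ((derivative^[k] P).eval y)) → ¬ x < y := fun {x y} hx h hlt => by
    refine hP (eq_zero_of_infinite_isRoot P ((Set.Icc_infinite hlt).mono fun z hz => ?_))
    have := sign_eq_of_sign_derivatives_eq P h z hz
    rw [hx, sign_zero, sign_eq_zero_iff] at this
    exact this
  have hy : P.eval y = 0 := by
    have := h 0
    rw [Function.iterate_zero, id, hx, sign_zero, eq_comm, sign_eq_zero_iff] at this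
    exact this
  exact le_antisymm (not_lt.1 (key hy fun k => (h k).symm)) (not_lt.1 (key hx h))

/-- A bivariate polynomial in the variables `u` and `v` of a larger set of variables. -/
noncomputable def ofBivariate {ι : Type} (u v : ι) (G : ℝ[X][X]) : MvPolynomial ι ℝ :=
  G.eval₂ (aeval (MvPolynomial.X u) : ℝ[X] →ₐ[ℝ] MvPolynomial ι ℝ).toRingHom (MvPolynomial.X v)

theorem eval_ofBivariate {ι : Type} (u v : ι) (G : ℝ[X][X]) (z : ι → ℝ) :
    MvPolynomial.eval z (ofBivariate u v G) = (G.map (evalRingHom (z u))).eval (z v) := by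
  rw [ofBivariate, Polynomial.hom_eval₂, eval_map, MvPolynomial.eval_X]
  congr 1
  ext <;> simp

/-- The graph of an algebraic analytic function over a small interval `(0, ε)` is semialgebraic:
the signs of the derivatives of its equation single out the right root. -/
theorem isSemialgebraic_graph_right {ι : Type} (u v : ι) {p : ℝ → ℝ} (hp : AnalyticAt ℝ p 0)
    {G : ℝ[X][X]} (hG : G ≠ 0) (h : ∀ᶠ s in 𝓝 0, (G.map (evalRingHom s)).eval (p s) = 0) :
    ∀ᶠ ε in 𝓝[>] (0 : ℝ), IsSemialgebraic {z : ι → ℝ | (0 < z u ∧ z u < ε) ∧ z v = p (z u)} := by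
  have han : ∀ H : ℝ[X][X], AnalyticAt ℝ (fun s => (H.map (evalRingHom s)).eval (p s)) 0 := by
    intro H
    have : (fun s => (H.map (evalRingHom s)).eval (p s))
        = fun s => ∑ k ∈ H.support, (H.coeff k).eval s * p s ^ k := by
      funext s
      rw [eval_map, eval₂_eq_sum, Polynomial.sum]
      rfl
    rw [this]
    exact Finset.analyticAt_fun_sum _ fun k _ =>
      (AnalyticOnNhd.eval_polynomial (H.coeff k) 0 trivial).mul (hp.pow k)
  choose σ hσ using fun k => (han (derivative^[k] G)).eventually_sign_eq_right
  -- the leading coefficient has no zeros near the origin except possibly the origin itself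
  have hlead : ∀ᶠ s in 𝓝[>] (0 : ℝ), G.map (evalRingHom s) ≠ 0 := by
    have h1 : ∀ᶠ s in 𝓝[>] (0 : ℝ), G.leadingCoeff.eval s ≠ 0 := by
      rcases (AnalyticOnNhd.eval_polynomial G.leadingCoeff (0 : ℝ)
        trivial).eventually_eq_zero_or_eventually_ne_zero with h0 | h0
      · exfalso
        refine leadingCoeff_ne_zero.2 hG (eq_zero_of_infinite_isRoot _ ?_)
        exact infinite_of_mem_nhds 0 h0
      · exact h0.filter_mono (nhdsWithin_mono _ fun s hs => ne_of_gt hs)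
    filter_upwards [h1] with s hs h0
    apply hs
    have := congrArg (fun P => coeff P G.natDegree) h0
    simp only [coeff_map, coeff_zero] at this
    exact this
  have hall : ∀ᶠ s in 𝓝[>] (0 : ℝ), (G.map (evalRingHom s) ≠ 0 ∧
      (G.map (evalRingHom s)).eval (p s) = 0) ∧ ∀ k ∈ Finset.range (G.natDegree + 1),
        SignType.sign (((derivative^[k] G).map (evalRingHom s)).eval (p s)) = σ k :=
    (hlead.and (h.filter_mono nhdsWithin_le_nhds)).and
      ((Filter.eventually_all_finset _).2 fun k _ => hσ k)
  obtain ⟨ε₀, hε₀, hall⟩ := mem_nhdsGT_iff_exists_Ioo_subset.1 hall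
  filter_upwards [Ioo_mem_nhdsGT hε₀] with ε hε
  have hset : {z : ι → ℝ | (0 < z u ∧ z u < ε) ∧ z v = p (z u)}
      = ({z | 0 < MvPolynomial.eval z (MvPolynomial.X u)}
        ∩ {z | 0 < MvPolynomial.eval z (MvPolynomial.C ε - MvPolynomial.X u)})
        ∩ {z | ∀ k ∈ Finset.range (G.natDegree + 1), z ∈ {z | SignType.sign
          (MvPolynomial.eval z (ofBivariate u v (derivative^[k] G))) = σ k}} := by
    ext z
    simp only [Set.mem_ofPred_eq, Set.mem_inter_iff, eval_ofBivariate, MvPolynomial.eval_X,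
      map_sub, MvPolynomial.eval_C, sub_pos]
    refine and_congr_right fun hz => ?_
    obtain ⟨⟨h1, h2⟩, h3⟩ := hall ⟨hz.1, hz.2.trans hε.2⟩
    constructor
    · intro hv
      rw [hv]
      exact h3
    · intro hv
      refine (root_eq_of_sign_derivatives_eq h1 h2 fun k => ?_).symm
      rw [Polynomial.iterate_derivative_map]
      by_cases hk : k ∈ Finset.range (G.natDegree + 1)
      · rw [h3 k hk, hv k hk]
      · rw [iterate_derivative_eq_zero (by rw [Finset.mem_range] at hk; omega)]
        simp
  rw [hset]
  exact ((IsSemialgebraic.pos _).inter (IsSemialgebraic.pos _)).inter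
    (IsSemialgebraic.biInter _ fun k _ => IsSemialgebraic.sign_eq _ _)

theorem isSemialgebraic_graph_pi_right {n : ℕ} {h : Fin n → ℝ → ℝ}
    (hh : ∀ i, AnalyticAt ℝ (h i) 0)
    (halg : ∀ i, ∃ G : ℝ[X][X], G ≠ 0 ∧ ∀ᶠ s in 𝓝 0, (G.map (evalRingHom s)).eval (h i s) = 0) :
    ∀ᶠ ε in 𝓝[>] (0 : ℝ), IsSemialgebraic {z : Fin 1 ⊕ Fin n → ℝ |
      (0 < z (.inl 0) ∧ z (.inl 0) < ε) ∧ ∀ i, z (.inr i) = h i (z (.inl 0))} := by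
  choose G hG hG0 using halg
  filter_upwards [Filter.eventually_all.2 fun i => isSemialgebraic_graph_right
    (Sum.inl 0 : Fin 1 ⊕ Fin n) (Sum.inr i) (hh i) (hG i) (hG0 i)] with ε hε
  have : {z : Fin 1 ⊕ Fin n → ℝ |
      (0 < z (.inl 0) ∧ z (.inl 0) < ε) ∧ ∀ i, z (.inr i) = h i (z (.inl 0))}
      = ({z | 0 < MvPolynomial.eval z (MvPolynomial.X (.inl 0))}
        ∩ {z | 0 < MvPolynomial.eval z (MvPolynomial.C ε - MvPolynomial.X (.inl 0))})
        ∩ {z | ∀ i ∈ Finset.univ, z ∈ {z : Fin 1 ⊕ Fin n → ℝ |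
          (0 < z (.inl 0) ∧ z (.inl 0) < ε) ∧ z (.inr i) = h i (z (.inl 0))}} := by
    ext z
    simp only [Set.mem_ofPred_eq, Set.mem_inter_iff, MvPolynomial.eval_X,
      map_sub, MvPolynomial.eval_C, sub_pos, Finset.mem_univ, true_imp_iff]
    refine and_congr_right fun hz => forall_congr' fun i => ?_
    simp [hz]
  rw [this]
  exact ((IsSemialgebraic.pos _).inter (IsSemialgebraic.pos _)).inter
    (IsSemialgebraic.biInter _ fun i _ => hε i)

theorem exists_bivariate_of_isAlgebraic {f : analyticFun} (h : IsAlgebraic ℝ[X] (germ f)) :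
    ∃ G : ℝ[X][X], G ≠ 0 ∧
      ∀ᶠ s in 𝓝 0, (G.map (evalRingHom s)).eval ((f : ℝ → ℝ) s) = 0 := by
  obtain ⟨G, hG, h0⟩ := h
  refine ⟨G, hG, ?_⟩
  have h1 : aeval (germ f) G = germ (∑ k ∈ G.support, aeval idFun (G.coeff k) * f ^ k) := by
    rw [aeval_def, eval₂_eq_sum, Polynomial.sum]
    refine Eq.trans ?_ (map_sum (Ideal.Quotient.mk zeroGermIdeal) _ _).symm
    refine Finset.sum_congr rfl fun k _ => ?_
    rw [map_mul, map_pow, algebraMap_polynomial]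
    congr 1
    exact Polynomial.aeval_algHom_apply (Ideal.Quotient.mkₐ ℝ zeroGermIdeal) idFun (G.coeff k)
  rw [h1, germ_eq_zero] at h0
  have h2 : ∀ (q : ℝ[X]) (s : ℝ), ((aeval idFun q : analyticFun) : ℝ → ℝ) s = q.eval s := by
    intro q s
    induction q using Polynomial.induction_on' with
    | add p q hp hq => simp [hp, hq]
    | monomial k c => simp [idFun, aeval_monomial, Algebra.algebraMap_eq_smul_one]
  filter_upwards [h0] with s hs
  rw [eval_map, eval₂_eq_sum, Polynomial.sum, ← hs]
  simp [Finset.sum_apply, h2]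

/-- An arc with algebraic analytic coordinates is Nash near the origin. -/
theorem eventually_isNashOn_arc {n : ℕ} {f : Fin n → analyticFun}
    (halg : ∀ i, IsAlgebraic ℝ[X] (germ (f i))) :
    ∀ᶠ c in 𝓝[>] (0 : ℝ), IsNashOn (fun t : Fin 1 → ℝ => arc f (c * t 0))
      {t | t 0 ∈ Set.Icc (-1) 1} := by
  have halg' := fun i => exists_bivariate_of_isAlgebraic (halg i)
  have hright := isSemialgebraic_graph_pi_right (fun i => (f i).2) halg'
  have hleft := isSemialgebraic_graph_pi_right (h := fun i s => (f i : ℝ → ℝ) (-s))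
    (fun i => AnalyticAt.fun_comp (g := (f i : ℝ → ℝ)) (by rw [neg_zero]; exact (f i).2)
      analyticAt_id.fun_neg) (fun i => by
      obtain ⟨G, hG, h⟩ := halg' i
      refine ⟨G.map (compRingHom (-X)), ?_, ?_⟩
      · rwa [Ne, Polynomial.map_eq_zero_iff]
        intro p q hpq
        have := congrArg (fun r => r.comp (-X)) hpq
        simpa [comp_assoc] using this
      · have ht : Tendsto (fun s : ℝ => -s) (𝓝 0) (𝓝 0) := by
          simpa using (continuous_neg (G := ℝ)).tendsto 0
        filter_upwards [ht.eventually h] with s hs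
        rw [Polynomial.map_map]
        convert hs using 3
        ext <;> simp)
  have han : ∀ᶠ s in 𝓝 (0 : ℝ), ∀ i, AnalyticAt ℝ (f i : ℝ → ℝ) s :=
    Filter.eventually_all.2 fun i => (f i).2.eventually_analyticAt
  obtain ⟨δ, hδ, han⟩ := Metric.eventually_nhds_iff.1 han
  have h2 : Tendsto (fun c : ℝ => 2 * c) (𝓝[>] 0) (𝓝[>] 0) := by
    refine tendsto_nhdsWithin_iff.2 ⟨?_, ?_⟩
    · have : Tendsto (fun c : ℝ => 2 * c) (𝓝 0) (𝓝 (2 * 0)) :=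
        (continuous_const_mul (2 : ℝ)).tendsto 0
      rw [mul_zero] at this
      exact this.mono_left nhdsWithin_le_nhds
    · filter_upwards [self_mem_nhdsWithin] with c hc
      exact mul_pos (two_pos (α := ℝ)) hc
  filter_upwards [h2.eventually hright, h2.eventually hleft, self_mem_nhdsWithin,
    h2.eventually (Ioo_mem_nhdsGT hδ)] with c hr hl hc hcδ
  replace hc : 0 < c := hc
  -- the substitutions of `± c * t` for the time `t`
  let sub : ℝ → Fin 1 ⊕ Fin n → MvPolynomial (Fin 1 ⊕ Fin n) ℝ := fun a =>
    Sum.elim (fun _ => MvPolynomial.C a * MvPolynomial.X (.inl 0)) fun i => MvPolynomial.X (.inr i)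
  refine ⟨{t | -2 < t 0 ∧ t 0 < 2}, fun t => arc f (c * t 0), ?_, ?_, ?_, ?_, ?_, fun _ _ => rfl⟩
  · exact (isOpen_lt continuous_const (continuous_apply 0)).inter
      (isOpen_lt (continuous_apply 0) continuous_const)
  · have := (IsSemialgebraic.pos
      (MvPolynomial.X 0 + MvPolynomial.C 2 : MvPolynomial (Fin 1) ℝ)).inter
      (IsSemialgebraic.pos (MvPolynomial.C 2 - MvPolynomial.X 0 : MvPolynomial (Fin 1) ℝ))
    convert this using 1
    ext t
    simp [neg_lt_iff_pos_add]
  · intro t ht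
    exact ⟨by linarith [ht.1], by linarith [ht.2]⟩
  · have hset : graphOver (fun t : Fin 1 → ℝ => arc f (c * t 0)) {t | -2 < t 0 ∧ t 0 < 2}
        = ({z | (fun i => MvPolynomial.eval z (sub c i)) ∈ {z : Fin 1 ⊕ Fin n → ℝ |
            (0 < z (.inl 0) ∧ z (.inl 0) < 2 * c) ∧
              ∀ i, z (.inr i) = (f i : ℝ → ℝ) (z (.inl 0))}}
          ∪ {z | (fun i => MvPolynomial.eval z (sub (-c) i)) ∈ {z : Fin 1 ⊕ Fin n → ℝ |
            (0 < z (.inl 0) ∧ z (.inl 0) < 2 * c) ∧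
              ∀ i, z (.inr i) = (f i : ℝ → ℝ) (-z (.inl 0))}})
          ∪ ({z | MvPolynomial.eval z (MvPolynomial.X (.inl 0)) = 0}
            ∩ {z | ∀ i ∈ Finset.univ, z ∈ {z | MvPolynomial.eval z (MvPolynomial.X (.inr i)
              - MvPolynomial.C ((f i : ℝ → ℝ) 0)) = 0}}) := by
      ext z
      simp only [graphOver, arc, sub, funext_iff, Set.mem_ofPred_eq, Set.mem_union,
        Set.mem_inter_iff, Sum.elim_inl, Sum.elim_inr, map_mul, map_sub, MvPolynomial.eval_C,
        MvPolynomial.eval_X, Finset.mem_univ, true_imp_iff, sub_eq_zero, neg_mul, neg_neg]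
      constructor
      · rintro ⟨⟨h1, h2⟩, h3⟩
        rcases lt_trichotomy (z (.inl 0)) 0 with h0 | h0 | h0
        · exact Or.inl (Or.inr ⟨⟨by nlinarith, by nlinarith⟩, h3⟩)
        · exact Or.inr ⟨h0, fun i => by rw [h3 i, h0, mul_zero]⟩
        · exact Or.inl (Or.inl ⟨⟨by nlinarith, by nlinarith⟩, h3⟩)
      · rintro ((⟨⟨h1, h2⟩, h3⟩ | ⟨⟨h1, h2⟩, h3⟩) | ⟨h0, h3⟩)
        · exact ⟨⟨by nlinarith, by nlinarith⟩, h3⟩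
        · exact ⟨⟨by nlinarith, by nlinarith⟩, h3⟩
        · exact ⟨by simp [h0], fun i => by rw [h3 i, h0, mul_zero]⟩
    rw [hset]
    exact ((hr.preimage _).union (hl.preimage _)).union ((IsSemialgebraic.eq_zero _).inter
      (IsSemialgebraic.biInter _ fun i _ => IsSemialgebraic.eq_zero _))
  · intro t ht
    refine ContDiffAt.contDiffWithinAt ?_
    refine contDiffAt_pi.2 fun i => ?_
    have h1 : AnalyticAt ℝ (f i : ℝ → ℝ) (c * t 0) := by
      refine han ?_ i
      rw [Real.dist_eq, sub_zero, abs_lt]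
      constructor <;> nlinarith [ht.1, ht.2, hcδ.2]
    exact ContDiffAt.comp (g := (f i : ℝ → ℝ)) (f := fun t : Fin 1 → ℝ => c * t 0) t
      h1.contDiffAt (by fun_prop)

/-! ### Nash bridges from analytic arcs -/

theorem ne_of_deriv_ne_zero {p : ℝ → ℝ} {x y : ℝ} (hxy : x < y)
    (hc : ContinuousOn p (Set.Icc x y)) (hd : ∀ s ∈ Set.Ioo x y, deriv p s ≠ 0) : p x ≠ p y :=
  fun h => by
    obtain ⟨s, hs, h0⟩ := exists_deriv_eq_zero hxy hc h
    exact hd s hs h0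

/-- An arc is injective near the origin if its two halves run in disjoint sets or if its derivative
at the origin is nonzero. In either case the derivative of some coordinate has no zeros near the
origin except possibly the origin itself, and Rolle's theorem applies to each half of the arc, or
to the whole arc. -/
theorem eventually_injOn_arc {n : ℕ} {f : Fin n → analyticFun} {A B : Set (Fin n → ℝ)}
    (hA : ∀ᶠ s in 𝓝[<] 0, arc f s ∈ A) (hB : ∀ᶠ s in 𝓝[>] 0, arc f s ∈ B)
    (h : Disjoint A B ∨ ∃ i, deriv (f i : ℝ → ℝ) 0 ≠ 0) :
    ∀ᶠ c in 𝓝[>] (0 : ℝ), Set.InjOn (arc f) (Set.Icc (-c) c) := by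
  have hex : ∃ i, (∀ᶠ s in 𝓝[≠] 0, deriv (f i : ℝ → ℝ) s ≠ 0) ∧
      (Disjoint A B ∨ deriv (f i : ℝ → ℝ) 0 ≠ 0) := by
    rcases h with h | ⟨i, hi⟩
    · by_contra! hno
      have hconst : ∀ i, ∀ᶠ s in 𝓝 0, deriv (f i : ℝ → ℝ) s = 0 := fun i =>
        (f i).2.deriv.eventually_eq_zero_or_eventually_ne_zero.resolve_right
          fun h' => (hno i h').1 h
      obtain ⟨δ, hδ, hball⟩ := Metric.eventually_nhds_iff_ball.1
        ((Filter.eventually_all.2 hconst).and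
          (Filter.eventually_all.2 fun i => (f i).2.eventually_analyticAt))
      have hlt : ∀ᶠ s in 𝓝[>] (0 : ℝ), arc f (-s) ∈ A :=
        (show Tendsto (fun s : ℝ => -s) (𝓝[>] 0) (𝓝[<] 0) by
          simpa using tendsto_neg_nhdsGT (a := (0 : ℝ))).eventually hA
      obtain ⟨s, ⟨h1, h2⟩, h3⟩ := ((hlt.and hB).and (Ioo_mem_nhdsGT hδ)).exists
      refine Set.disjoint_left.1 h h1 ?_
      have : arc f (-s) = arc f s := funext fun i =>
        Metric.isOpen_ball.is_const_of_deriv_eq_zero (convex_ball (0 : ℝ) δ).isPreconnected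
          (fun x hx => ((hball x hx).2 i).differentiableAt.differentiableWithinAt)
          (fun x hx => (hball x hx).1 i)
          (by simpa [abs_of_pos h3.1] using h3.2) (by simpa [abs_of_pos h3.1] using h3.2)
      rwa [this]
    · refine ⟨i, ?_, Or.inr hi⟩
      exact ((f i).2.deriv.continuousAt.eventually_ne hi).filter_mono nhdsWithin_le_nhds
  obtain ⟨i, hi, h⟩ := hex
  rw [eventually_nhdsWithin_iff] at hi hA hB
  obtain ⟨δ, hδ, hball⟩ := Metric.eventually_nhds_iff.1
    ((hi.and (hA.and hB)).and (f i).2.eventually_analyticAt)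
  filter_upwards [Ioo_mem_nhdsGT hδ] with c hc
  have hin : ∀ s ∈ Set.Icc (-c) c, dist s 0 < δ := fun s hs => by
    rw [Real.dist_eq, sub_zero]
    exact (abs_le.2 hs).trans_lt hc.2
  have key : ∀ x ∈ Set.Icc (-c) c, ∀ y ∈ Set.Icc (-c) c, x < y → arc f x ≠ arc f y := by
    intro x hx y hy hxy heq
    have hsub : ∀ s ∈ Set.Icc x y, dist s 0 < δ := fun s hs =>
      hin s ⟨hx.1.trans hs.1, hs.2.trans hy.2⟩
    have hcont : ContinuousOn (f i : ℝ → ℝ) (Set.Icc x y) := fun s hs =>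
      (hball (hsub s hs)).2.continuousAt.continuousWithinAt
    by_cases hside : Disjoint A B ∧ x < 0 ∧ 0 < y
    · refine Set.disjoint_left.1 hside.1 ((hball (hin x hx)).1.2.1 hside.2.1) ?_
      rw [heq]
      exact (hball (hin y hy)).1.2.2 hside.2.2
    · refine ne_of_deriv_ne_zero hxy hcont (fun s hs => ?_) (congrFun heq i)
      by_cases hs0 : s = 0
      · subst hs0
        exact h.resolve_left fun hdis => hside ⟨hdis, hs.1, hs.2⟩
      · exact (hball (hsub s ⟨hs.1.le, hs.2.le⟩)).1.1 hs0
  intro x hx y hy heq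
  rcases lt_trichotomy x y with hxy | hxy | hxy
  · exact absurd heq (key x hx y hy hxy)
  · exact hxy
  · exact absurd heq.symm (key y hy x hx hxy)

theorem deriv_eq_of_close {p q : analyticFun} (h : unif ^ 2 ∣ germ q - germ p) :
    deriv (q : ℝ → ℝ) 0 = deriv (p : ℝ → ℝ) 0 := by
  obtain ⟨c, hc⟩ := h
  obtain ⟨c, rfl⟩ := germ_surjective c
  have hq : germ q = germ (p + idFun * (idFun * c)) := by
    simp only [map_mul, map_add]
    linear_combination hc
  have h1 : HasDerivAt (fun s => (p : ℝ → ℝ) s + s * (s * (c : ℝ → ℝ) s))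
      (deriv (p : ℝ → ℝ) 0 + (1 * (0 * (c : ℝ → ℝ) 0)
        + 0 * (1 * (c : ℝ → ℝ) 0 + 0 * deriv (c : ℝ → ℝ) 0))) 0 :=
    p.2.differentiableAt.hasDerivAt.fun_add
      ((hasDerivAt_id (0 : ℝ)).fun_mul
        ((hasDerivAt_id (0 : ℝ)).fun_mul c.2.differentiableAt.hasDerivAt))
  have h2 : (q : ℝ → ℝ) =ᶠ[𝓝 0] fun s => (p : ℝ → ℝ) s + s * (s * (c : ℝ → ℝ) s) := by
    filter_upwards [germ_eq_germ.1 hq] with s hs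
    rw [hs]
    simp [idFun]
  rw [h2.deriv_eq, h1.deriv]
  ring

/-- An analytic arc that passes at time `0` from `A` to `B` can be replaced by a Nash bridge: an
algebraic approximation of high order satisfies the same polynomial equations, and so lies on the
same sides of all the polynomials that define `A` and `B`. -/
theorem exists_nashBridge {n : ℕ} {S A B : Set (Fin n → ℝ)} (hA : IsSemialgebraic A)
    (hB : IsSemialgebraic B) (hAS : A ⊆ S) (hBS : B ⊆ S) {α : ℝ → Fin n → ℝ}
    (hα : AnalyticAt ℝ α 0) (h0 : α 0 ∈ S) (hαA : ∀ᶠ s in 𝓝[<] 0, α s ∈ A)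
    (hαB : ∀ᶠ s in 𝓝[>] 0, α s ∈ B)
    (h : Disjoint A B ∨ ∃ i, deriv (fun s => α s i) 0 ≠ 0) :
    ∃ Γ ⊆ S, IsNashBridge A B Γ := by
  let f : Fin n → analyticFun := fun i => ⟨fun s => α s i, analyticAt_pi_iff.1 hα i⟩
  obtain ⟨M₁, hM₁⟩ := hA.exists_order f
  obtain ⟨M₂, hM₂⟩ := hB.exists_order f
  -- order `2` preserves the value and the derivative at the origin
  obtain ⟨b, hb, hclose, hrel⟩ :=
    exists_algebraic_approx n (fun i => germ (f i)) (max 2 (max M₁ M₂))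
  choose f' hf' using fun i => germ_surjective (b i)
  obtain rfl : (fun i => germ (f' i)) = b := funext hf'
  have hclose' : ∀ k ≤ max 2 (max M₁ M₂), ∀ i, unif ^ k ∣ germ (f' i) - germ (f i) :=
    fun k hk i => (pow_dvd_pow _ hk).trans (hclose i)
  have hA' : ∀ᶠ s in 𝓝[<] 0, arc f' s ∈ A := by
    filter_upwards [hαA, (hM₁ f' (hclose' _ (by simp)) hrel).filter_mono
      (nhdsWithin_mono _ fun s hs => ne_of_lt hs)] with s h1 h2
    exact h2.1 h1
  have hB' : ∀ᶠ s in 𝓝[>] 0, arc f' s ∈ B := by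
    filter_upwards [hαB, (hM₂ f' (hclose' _ (by simp)) hrel).filter_mono
      (nhdsWithin_mono _ fun s hs => ne_of_gt hs)] with s h1 h2
    exact h2.1 h1
  have h0' : arc f' 0 = α 0 := by
    funext i
    have h1 := hclose' 1 (le_trans (by norm_num) (le_max_left _ _)) i
    have h2 : germ (f' i) - germ (f i) = germ (f' i - f i) :=
      (map_sub (Ideal.Quotient.mk zeroGermIdeal) _ _).symm
    rw [pow_one, h2, unif_dvd_iff] at h1
    exact sub_eq_zero.1 h1
  have hinj := eventually_injOn_arc hA' hB' (h.imp_right fun ⟨i, hi⟩ => ⟨i, by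
    rwa [deriv_eq_of_close (hclose' 2 (le_max_left _ _) i)]⟩)
  obtain ⟨δ₁, hδ₁, hA'⟩ := mem_nhdsLT_iff_exists_Ioo_subset.1 hA'
  obtain ⟨δ₂, hδ₂, hB'⟩ := mem_nhdsGT_iff_exists_Ioo_subset.1 hB'
  have hδ₁' : ∀ᶠ c in 𝓝[>] (0 : ℝ), c ∈ Set.Ioo 0 (-δ₁) :=
    Ioo_mem_nhdsGT (neg_pos.2 (Set.mem_Iio.1 hδ₁))
  obtain ⟨c, ⟨hc1, hc2⟩, hc3, hc4⟩ := (((eventually_isNashOn_arc hb).and hinj).and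
    (hδ₁'.and (Ioo_mem_nhdsGT hδ₂))).exists
  have hcpos : 0 < c := hc3.1
  have hmA : Set.MapsTo (fun s => arc f' (c * s)) (Set.Ico (-1) 0) A := fun s hs =>
    hA' ⟨by nlinarith [hs.1, hc3.2], by nlinarith [hs.2]⟩
  have hmB : Set.MapsTo (fun s => arc f' (c * s)) (Set.Ioc 0 1) B := fun s hs =>
    hB' ⟨by nlinarith [hs.1], by nlinarith [hs.2, hc4.2]⟩
  refine ⟨(fun s => arc f' (c * s)) '' Set.Icc (-1) 1, ?_, fun s => arc f' (c * s),
    ⟨hc1, ?_⟩, hmA, hmB, rfl⟩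
  · rintro _ ⟨s, hs, rfl⟩
    rcases lt_trichotomy s 0 with h | h | h
    · exact hAS (hmA ⟨hs.1, h⟩)
    · simpa [h, h0'] using h0
    · exact hBS (hmB ⟨h, hs.2⟩)
  · intro x hx y hy hxy
    have := hc2 (x₁ := c * x) (x₂ := c * y) ⟨by nlinarith [hx.1], by nlinarith [hx.2]⟩
      ⟨by nlinarith [hy.1], by nlinarith [hy.2]⟩ hxy
    exact mul_left_cancel₀ hcpos.ne' this

end

open Filter

/-! ### Generic points of a semialgebraic set -/

/-- Near a generic point of the zero set of a prime ideal, every point of that zero set lies in a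
given semialgebraic set, or none does. -/
theorem IsSemialgebraic.exists_locally_const {n : ℕ} {T : Set (Fin n → ℝ)}
    (hT : IsSemialgebraic T) (P : Ideal (MvPolynomial (Fin n) ℝ)) [P.IsPrime] :
    ∃ g ∉ P, ∀ x ∈ MvPolynomial.zeroLocus ℝ P, MvPolynomial.eval x g ≠ 0 →
      ∀ᶠ x' in 𝓝[MvPolynomial.zeroLocus ℝ P] x, (x' ∈ T ↔ x ∈ T) := by
  have hone : (1 : MvPolynomial (Fin n) ℝ) ∉ P :=
    (Ideal.ne_top_iff_one P).1 (Ideal.IsPrime.ne_top inferInstance)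
  induction hT with
  | eq_zero p =>
    by_cases hp : p ∈ P
    · refine ⟨1, hone, fun x hx _ => ?_⟩
      filter_upwards [self_mem_nhdsWithin] with x' hx'
      have h1 := hx p hp
      have h2 := hx' p hp
      rw [MvPolynomial.aeval_eq_eval] at h1 h2
      exact iff_of_true h2 h1
    · refine ⟨p, hp, fun x _ hx => ?_⟩
      filter_upwards [((MvPolynomial.continuous_eval p).continuousAt.eventually_ne
        hx).filter_mono nhdsWithin_le_nhds] with x' hx'
      exact iff_of_false hx' hx
  | pos p =>
    by_cases hp : p ∈ P
    · refine ⟨1, hone, fun x hx _ => ?_⟩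
      filter_upwards [self_mem_nhdsWithin] with x' hx'
      have h1 := hx p hp
      have h2 := hx' p hp
      rw [MvPolynomial.aeval_eq_eval] at h1 h2
      exact iff_of_false (fun h => h.ne' h2) (fun h => h.ne' h1)
    · refine ⟨p, hp, fun x _ hx => ?_⟩
      have hc := (MvPolynomial.continuous_eval p).continuousAt (x := x)
      rcases lt_or_gt_of_ne hx with h | h
      · filter_upwards [(hc.eventually (gt_mem_nhds h)).filter_mono nhdsWithin_le_nhds]
          with x' hx'
        exact iff_of_false (not_lt_of_gt hx') (not_lt_of_gt h)
      · filter_upwards [(hc.eventually (lt_mem_nhds h)).filter_mono nhdsWithin_le_nhds]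
          with x' hx'
        exact iff_of_true hx' h
  | compl _ ih =>
    obtain ⟨g, hg, h⟩ := ih
    exact ⟨g, hg, fun x hx hgx => (h x hx hgx).mono fun x' hx' => not_congr hx'⟩
  | inter _ _ ih₁ ih₂ =>
    obtain ⟨g₁, hg₁, h₁⟩ := ih₁
    obtain ⟨g₂, hg₂, h₂⟩ := ih₂
    refine ⟨g₁ * g₂, fun h => (Ideal.IsPrime.mem_or_mem inferInstance h).elim hg₁ hg₂,
      fun x hx hgx => ?_⟩
    rw [map_mul] at hgx
    filter_upwards [h₁ x hx (left_ne_zero_of_mul hgx), h₂ x hx (right_ne_zero_of_mul hgx)]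
      with x' h₁' h₂'
    exact and_congr h₁' h₂'
  | union _ _ ih₁ ih₂ =>
    obtain ⟨g₁, hg₁, h₁⟩ := ih₁
    obtain ⟨g₂, hg₂, h₂⟩ := ih₂
    refine ⟨g₁ * g₂, fun h => (Ideal.IsPrime.mem_or_mem inferInstance h).elim hg₁ hg₂,
      fun x hx hgx => ?_⟩
    rw [map_mul] at hgx
    filter_upwards [h₁ x hx (left_ne_zero_of_mul hgx), h₂ x hx (right_ne_zero_of_mul hgx)]
      with x' h₁' h₂'
    exact or_congr h₁' h₂'

/-- A minimal prime of a radical ideal becomes equal to the ideal after inverting one element. -/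
theorem exists_mul_mem_of_minimalPrime {R : Type*} [CommRing R] [IsNoetherianRing R] {I : Ideal R}
    (hI : I.IsRadical) {P : Ideal R} (hP : P ∈ I.minimalPrimes) :
    ∃ q ∉ P, ∀ f ∈ P, f * q ∈ I := by
  classical
  have hPprime : P.IsPrime := hP.1.1
  have hfin : I.minimalPrimes.Finite := Ideal.finite_minimalPrimes_of_isNoetherianRing R I
  have hex : ∀ Q ∈ hfin.toFinset.erase P, ∃ q ∈ Q, q ∉ P := fun Q hQ => by
    obtain ⟨hne, hQ⟩ := Finset.mem_erase.1 hQ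
    rw [Set.Finite.mem_toFinset] at hQ
    by_contra! hle
    exact hne (le_antisymm hle (hP.2 hQ.1 hle))
  choose! q hq hqP using hex
  refine ⟨∏ Q ∈ hfin.toFinset.erase P, q Q, fun h => ?_, fun f hf => ?_⟩
  · obtain ⟨Q, hQ, h⟩ := (Ideal.IsPrime.prod_mem_iff).1 h
    exact hqP Q hQ h
  · refine hI.radical.le ?_
    rw [← Ideal.sInf_minimalPrimes, Submodule.mem_sInf]
    intro Q hQ
    by_cases hQP : Q = P
    · exact Ideal.mul_mem_right _ _ (hQP ▸ hf)
    · have hmem : Q ∈ hfin.toFinset.erase P :=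
        Finset.mem_erase.2 ⟨hQP, (Set.Finite.mem_toFinset _).2 hQ⟩
      exact Ideal.mul_mem_left _ _ (Ideal.mem_of_dvd _ (Finset.dvd_prod_of_mem q hmem) (hq Q hmem))

/-- If the quotients by two nested ideals have the same finite dimension, a minimal prime of the
smaller ideal contains the larger one; it is not maximal when the dimension is positive. -/
theorem exists_minimalPrime_of_ringKrullDim_eq {R : Type*} [CommRing R] {I J : Ideal R}
    (hIJ : I ≤ J) {d : ℕ} (hI : ringKrullDim (R ⧸ I) = d) (hJ : ringKrullDim (R ⧸ J) = d) :
    ∃ P ∈ I.minimalPrimes, J ≤ P ∧ (d ≠ 0 → ¬ P.IsMaximal) := by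
  rw [ringKrullDim_quotient] at hI hJ
  obtain ⟨l, hl⟩ := Order.le_krullDim_iff.1 hJ.ge
  have hJP : J ≤ l.head.1.asIdeal := l.head.2
  refine ⟨l.head.1.asIdeal, ?_, hJP, fun hd hmax => ?_⟩
  · obtain ⟨Q, hQ, hQP⟩ := Ideal.exists_minimalPrimes_le (hIJ.trans hJP)
    by_cases hne : Q = l.head.1.asIdeal
    · exact hne ▸ hQ
    exfalso
    let Q' : PrimeSpectrum.zeroLocus (I : Set R) := ⟨⟨Q, hQ.1.1⟩, hQ.1.2⟩
    let φ : PrimeSpectrum.zeroLocus (J : Set R) → PrimeSpectrum.zeroLocus (I : Set R) :=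
      fun x => ⟨x.1, PrimeSpectrum.zeroLocus_anti_mono hIJ x.2⟩
    have hφ : StrictMono φ := fun x y h => h
    have hlt : Q' < (l.map φ hφ).head := by
      rw [LTSeries.head_map]
      exact lt_of_le_of_ne hQP fun h => hne (congrArg (fun x => x.1.asIdeal) h)
    have := Order.LTSeries.length_le_krullDim ((l.map φ hφ).cons Q' hlt)
    rw [hI, RelSeries.cons_length, LTSeries.map_length, hl] at this
    norm_cast at this
    omega
  · have h1 : 0 < l.length := by omega
    have h2 : l.head.1.asIdeal < (l ⟨1, by omega⟩).1.asIdeal :=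
      l.strictMono (a := ⟨0, by omega⟩) (b := ⟨1, by omega⟩) (by simp [Fin.lt_def])
    exact (l ⟨1, by omega⟩).1.isPrime.ne_top (hmax.1.2 _ h2)

theorem vanishingIdeal_isRadical {n : ℕ} (S : Set (Fin n → ℝ)) :
    (MvPolynomial.vanishingIdeal ℝ S).IsRadical := by
  rintro p ⟨k, hk⟩ x hx
  have := hk x hx
  rw [map_pow] at this
  exact eq_zero_of_pow_eq_zero this

/-- On each irreducible component of the Zariski closure of `S`, the generic points of `S` have a
neighbourhood in `S` that lies in a given semialgebraic set or avoids it. -/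
theorem exists_generic_polynomial {n r : ℕ} (S : Set (Fin n → ℝ)) {T : Fin r → Set (Fin n → ℝ)}
    (hT : ∀ i, IsSemialgebraic (T i)) {P : Ideal (MvPolynomial (Fin n) ℝ)}
    (hP : P ∈ (MvPolynomial.vanishingIdeal ℝ S).minimalPrimes) :
    ∃ g ∉ P, ∀ x ∈ S, MvPolynomial.eval x g ≠ 0 → ∀ᶠ x' in 𝓝[S] x, ∀ i, (x' ∈ T i ↔ x ∈ T i) := by
  have hPprime : P.IsPrime := hP.1.1
  obtain ⟨q, hq, hqS⟩ := exists_mul_mem_of_minimalPrime (vanishingIdeal_isRadical S) hP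
  choose g hg h using fun i => (hT i).exists_locally_const P
  refine ⟨q * ∏ i, g i, fun hmem => ?_, fun x hx hgx => ?_⟩
  · rcases Ideal.IsPrime.mem_or_mem inferInstance hmem with hmem | hmem
    · exact hq hmem
    · obtain ⟨i, -, hi⟩ := (Ideal.IsPrime.prod_mem_iff).1 hmem
      exact hg i hi
  · rw [map_mul, map_prod] at hgx
    have hqx := left_ne_zero_of_mul hgx
    have hgx := Finset.prod_ne_zero_iff.1 (right_ne_zero_of_mul hgx)
    have hloc : ∀ x' ∈ S, MvPolynomial.eval x' q ≠ 0 → x' ∈ MvPolynomial.zeroLocus ℝ P := by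
      intro x' hx' hqx' f hf
      have h1 := hqS f hf x' hx'
      rw [MvPolynomial.aeval_eq_eval] at h1 ⊢
      rw [map_mul] at h1
      exact (mul_eq_zero.1 h1).resolve_right hqx'
    rw [Filter.eventually_all]
    intro i
    have h1 := h i x (hloc x hx hqx) (hgx i (Finset.mem_univ i))
    rw [eventually_nhdsWithin_iff] at h1 ⊢
    filter_upwards [h1, (MvPolynomial.continuous_eval q).continuousAt.eventually_ne hqx]
      with x' h2 h3 hx'
    exact h2 (hloc x' hx' h3)

/-! ### Following an analytic path -/

theorem tendsto_const_add_nhdsLT (t : ℝ) : Tendsto (fun s => t + s) (𝓝[<] 0) (𝓝[<] t) := by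
  refine tendsto_nhdsWithin_iff.2 ⟨?_, ?_⟩
  · have := (continuous_const_add t).tendsto (0 : ℝ)
    rw [add_zero] at this
    exact this.mono_left nhdsWithin_le_nhds
  · filter_upwards [self_mem_nhdsWithin] with s hs
    simpa using hs

theorem tendsto_const_add_nhdsGT (t : ℝ) : Tendsto (fun s => t + s) (𝓝[>] 0) (𝓝[>] t) := by
  refine tendsto_nhdsWithin_iff.2 ⟨?_, ?_⟩
  · have := (continuous_const_add t).tendsto (0 : ℝ)
    rw [add_zero] at this
    exact this.mono_left nhdsWithin_le_nhds
  · filter_upwards [self_mem_nhdsWithin] with s hs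
    simpa using hs

theorem exists_nashBridge_at {n : ℕ} {S A B : Set (Fin n → ℝ)} (hA : IsSemialgebraic A)
    (hB : IsSemialgebraic B) (hAS : A ⊆ S) (hBS : B ⊆ S) {α : ℝ → Fin n → ℝ} {t : ℝ}
    (hα : AnalyticAt ℝ α t) (ht : α t ∈ S) (hαA : ∀ᶠ s in 𝓝[<] t, α s ∈ A)
    (hαB : ∀ᶠ s in 𝓝[>] t, α s ∈ B)
    (h : Disjoint A B ∨ ∃ i, deriv (fun s => α s i) t ≠ 0) :
    ∃ Γ ⊆ S, IsNashBridge A B Γ := by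
  refine exists_nashBridge hA hB hAS hBS (α := fun s => α (t + s)) ?_ (by simpa using ht)
    ((tendsto_const_add_nhdsLT t).eventually hαA) ((tendsto_const_add_nhdsGT t).eventually hαB)
    (h.imp_right fun ⟨i, hi⟩ => ⟨i, ?_⟩)
  · exact AnalyticAt.fun_comp (g := α) (by simpa using hα) (analyticAt_const.fun_add analyticAt_id)
  · rw [deriv_comp_const_add (f := fun s => α s i), add_zero]
    exact hi

/-- A path that is analytic on the unit interval and constant near one of its points has equal end
points. -/
theorem AnalyticOnNhd.endpoints_eq {n : ℕ} {α : ℝ → Fin n → ℝ}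
    (hα : AnalyticOnNhd ℝ α (Set.Icc 0 1)) {t : ℝ} (ht : t ∈ Set.Icc (0 : ℝ) 1) {c : Fin n → ℝ}
    (h : ∀ i, ∀ᶠ s in 𝓝 t, α s i = c i) : α 0 = α 1 := by
  have h1 : Set.EqOn α (fun _ => c) (Set.Icc 0 1) :=
    hα.eqOn_of_preconnected_of_eventuallyEq analyticOnNhd_const isPreconnected_Icc ht
      ((Filter.eventually_all.2 h).mono fun s hs => funext hs)
  rw [h1 ⟨le_rfl, zero_le_one⟩, h1 ⟨zero_le_one, le_rfl⟩]

theorem reachable_of_bridge {n r : ℕ} {S : Set (Fin n → ℝ)} {T : Fin r → Set (Fin n → ℝ)}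
    {k l : Fin r} (h : ∃ Γ ⊆ S, IsNashBridge (T k) (T l) Γ) : (bridgeGraph S T).Reachable k l := by
  by_cases hkl : k = l
  · rw [hkl]
  · exact SimpleGraph.Adj.reachable ((SimpleGraph.fromRel_adj _ _ _).2 ⟨hkl, Or.inl h⟩)

/-- If the sets `T k` and `T l` share a piece of a nonconstant analytic path, they are joined by a
bridge, near a point where the path is regular. -/
theorem reachable_of_overlap {n r : ℕ} {S : Set (Fin n → ℝ)} {T : Fin r → Set (Fin n → ℝ)}
    (hT : ∀ i, IsSemialgebraic (T i)) (hTS : ∀ i, T i ⊆ S) {α : ℝ → Fin n → ℝ}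
    (hα : AnalyticOnNhd ℝ α (Set.Icc 0 1)) (hne : α 0 ≠ α 1) {u v : ℝ} (huv : u < v) {k l : Fin r}
    (h : ∀ s ∈ Set.Ioo u v, s ∈ Set.Icc (0 : ℝ) 1 ∧ α s ∈ T k ∧ α s ∈ T l) :
    (bridgeGraph S T).Reachable k l := by
  have hex : ∃ t ∈ Set.Ioo u v, ∃ i, deriv (fun s => α s i) t ≠ 0 := by
    by_contra! hno
    obtain ⟨t, ht⟩ := exists_between huv
    refine hne (hα.endpoints_eq (h t ht).1 (c := α t) fun i => ?_)
    filter_upwards [isOpen_Ioo.mem_nhds ht] with s hs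
    exact isOpen_Ioo.is_const_of_deriv_eq_zero (f := fun s => α s i) isPreconnected_Ioo
      (fun s hs => (analyticAt_pi_iff.1 (hα s (h s hs).1)
        i).differentiableAt.differentiableWithinAt) (fun s hs => hno s hs i) hs ht
  obtain ⟨t, ht, hi⟩ := hex
  have hnhds := isOpen_Ioo.mem_nhds ht
  refine reachable_of_bridge (exists_nashBridge_at (hT k) (hT l) (hTS k) (hTS l)
    (hα t (h t ht).1) (hTS k (h t ht).2.1) ?_ ?_ (Or.inr hi))
  · filter_upwards [mem_nhdsWithin_of_mem_nhds hnhds] with s hs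
    exact (h s hs).2.1
  · filter_upwards [mem_nhdsWithin_of_mem_nhds hnhds] with s hs
    exact (h s hs).2.2

/-- If a nonconstant analytic path comes from `T k` and continues in `T l`, then `k` and `l` are in
the same component. When the path does not continue in `T k` as well, it passes between the
disjoint sets `T k` and `T l \ T k`. -/
theorem reachable_of_passage {n r : ℕ} {S : Set (Fin n → ℝ)} {T : Fin r → Set (Fin n → ℝ)}
    (hT : ∀ i, IsSemialgebraic (T i)) (hTS : ∀ i, T i ⊆ S) {α : ℝ → Fin n → ℝ}
    (hα : AnalyticOnNhd ℝ α (Set.Icc 0 1)) (hαS : Set.MapsTo α (Set.Icc 0 1) S)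
    (hne : α 0 ≠ α 1) {t : ℝ} (ht : t ∈ Set.Ioo (0 : ℝ) 1) {k l : Fin r}
    (hk : ∀ᶠ s in 𝓝[<] t, α s ∈ T k) (hl : ∀ᶠ s in 𝓝[>] t, α s ∈ T l) :
    (bridgeGraph S T).Reachable k l := by
  have htI : t ∈ Set.Icc (0 : ℝ) 1 := ⟨ht.1.le, ht.2.le⟩
  rcases (hT k).eventually_mem_or (l := 𝓝[>] t) (α := α)
    (fun p => ((hα t htI).eval_mvPolynomial p).eventually_sign_eq_right) with h | h
  · obtain ⟨v, hv, hsub⟩ := mem_nhdsGT_iff_exists_Ioo_subset.1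
      ((h.and hl).and (Ioo_mem_nhdsGT ht.2))
    exact reachable_of_overlap hT hTS hα hne (Set.mem_Ioi.1 hv) fun s hs =>
      ⟨⟨ht.1.le.trans hs.1.le, (hsub hs).2.2.le⟩, (hsub hs).1⟩
  · have hB : IsSemialgebraic (T l \ T k) := (hT l).inter (hT k).compl
    obtain ⟨Γ, hΓ, α', h1, h2, h3, h4⟩ := exists_nashBridge_at (hT k) hB (hTS k)
      (Set.sdiff_subset.trans (hTS l)) (hα t htI) (hαS htI) hk (hl.and h)
      (Or.inl Set.disjoint_sdiff_right)
    exact reachable_of_bridge ⟨Γ, hΓ, α', h1, h2, h3.mono_right Set.sdiff_subset, h4⟩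

/-- The vertices at the two ends of an analytic path with generic initial point are connected: at
every time the one-sided germs of the path run in some of the sets `T k`. -/
theorem reachable_of_path {n r : ℕ} {S : Set (Fin n → ℝ)} {T : Fin r → Set (Fin n → ℝ)}
    (hT : ∀ i, IsSemialgebraic (T i)) (hTS : ∀ i, T i ⊆ S) {α : ℝ → Fin n → ℝ}
    (hα : AnalyticOnNhd ℝ α (Set.Icc 0 1)) (hαS : Set.MapsTo α (Set.Icc 0 1) S)
    (hne : α 0 ≠ α 1) {g : MvPolynomial (Fin n) ℝ} (hg0 : MvPolynomial.eval (α 0) g ≠ 0)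
    (hg : ∀ x ∈ S, MvPolynomial.eval x g ≠ 0 → ∃ k, x ∈ T k) {i j : Fin r}
    (hi : ∀ᶠ s in 𝓝[>] 0, α s ∈ T i) (hj : ∀ᶠ s in 𝓝[<] 1, α s ∈ T j) :
    (bridgeGraph S T).Reachable i j := by
  have hgα : AnalyticOnNhd ℝ (fun s => MvPolynomial.eval (α s) g) (Set.Icc 0 1) :=
    fun s hs => (hα s hs).eval_mvPolynomial g
  have hgen : ∀ t ∈ Set.Icc (0 : ℝ) 1, ∀ᶠ s in 𝓝[≠] t, MvPolynomial.eval (α s) g ≠ 0 := by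
    intro t ht
    refine (hgα t ht).eventually_eq_zero_or_eventually_ne_zero.resolve_left fun h => hg0 ?_
    exact hgα.eqOn_zero_of_preconnected_of_eventuallyEq_zero isPreconnected_Icc ht h
      ⟨le_rfl, zero_le_one⟩
  have hgerm : ∀ (f : Filter ℝ) [f.NeBot], (∀ᶠ s in f, s ∈ Set.Icc (0 : ℝ) 1) →
      (∀ᶠ s in f, MvPolynomial.eval (α s) g ≠ 0) →
      (∀ p : MvPolynomial (Fin n) ℝ,
        ∃ σ, ∀ᶠ s in f, SignType.sign (MvPolynomial.eval (α s) p) = σ) →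
      ∃ k, ∀ᶠ s in f, α s ∈ T k := by
    intro f _ h1 h2 h3
    by_contra hno
    have h4 : ∀ᶠ s in f, ∀ k, α s ∉ T k := Filter.eventually_all.2 fun k =>
      ((hT k).eventually_mem_or h3).resolve_left fun h => hno ⟨k, h⟩
    obtain ⟨s, ⟨h1, h2⟩, h4⟩ := ((h1.and h2).and h4).exists
    obtain ⟨k, hk⟩ := hg _ (hαS h1) h2
    exact h4 k hk
  -- the germ of the path at `t`, on one of the two sides, runs in `T k`
  let R : ℝ → Fin r → Prop := fun t k => (t < 1 ∧ ∀ᶠ s in 𝓝[>] t, α s ∈ T k) ∨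
    (0 < t ∧ ∀ᶠ s in 𝓝[<] t, α s ∈ T k)
  have hright : ∀ t ∈ Set.Ico (0 : ℝ) 1, ∃ k, ∀ᶠ s in 𝓝[>] t, α s ∈ T k := fun t ht => by
    have htI : t ∈ Set.Icc (0 : ℝ) 1 := ⟨ht.1, ht.2.le⟩
    refine hgerm _ ?_ ((hgen t htI).filter_mono (nhdsWithin_mono _ fun s hs => ne_of_gt hs))
      (fun p => ((hα t htI).eval_mvPolynomial p).eventually_sign_eq_right)
    filter_upwards [Ioo_mem_nhdsGT ht.2] with s hs
    exact ⟨ht.1.trans hs.1.le, hs.2.le⟩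
  have hleft : ∀ t ∈ Set.Ioc (0 : ℝ) 1, ∃ k, ∀ᶠ s in 𝓝[<] t, α s ∈ T k := fun t ht => by
    have htI : t ∈ Set.Icc (0 : ℝ) 1 := ⟨ht.1.le, ht.2⟩
    refine hgerm _ ?_ ((hgen t htI).filter_mono (nhdsWithin_mono _ fun s hs => ne_of_lt hs))
      (fun p => ((hα t htI).eval_mvPolynomial p).eventually_sign_eq_left)
    filter_upwards [Ioo_mem_nhdsLT ht.1] with s hs
    exact ⟨hs.1.le, hs.2.le.trans ht.2⟩
  have hRex : ∀ t ∈ Set.Icc (0 : ℝ) 1, ∃ k, R t k := fun t ht => by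
    rcases lt_or_ge t 1 with h1 | h1
    · obtain ⟨k, hk⟩ := hright t ⟨ht.1, h1⟩
      exact ⟨k, Or.inl ⟨h1, hk⟩⟩
    · obtain ⟨k, hk⟩ := hleft t ⟨zero_lt_one.trans_le h1, ht.2⟩
      exact ⟨k, Or.inr ⟨zero_lt_one.trans_le h1, hk⟩⟩
  have hrr : ∀ t ∈ Set.Icc (0 : ℝ) 1, t < 1 → ∀ k l, (∀ᶠ s in 𝓝[>] t, α s ∈ T k) →
      (∀ᶠ s in 𝓝[>] t, α s ∈ T l) → (bridgeGraph S T).Reachable k l := by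
    intro t ht h1 k l hk hl
    obtain ⟨v, hv, hsub⟩ := mem_nhdsGT_iff_exists_Ioo_subset.1
      ((hk.and hl).and (Ioo_mem_nhdsGT h1))
    exact reachable_of_overlap hT hTS hα hne (Set.mem_Ioi.1 hv) fun s hs =>
      ⟨⟨ht.1.trans hs.1.le, (hsub hs).2.2.le⟩, (hsub hs).1⟩
  have hll : ∀ t ∈ Set.Icc (0 : ℝ) 1, 0 < t → ∀ k l, (∀ᶠ s in 𝓝[<] t, α s ∈ T k) →
      (∀ᶠ s in 𝓝[<] t, α s ∈ T l) → (bridgeGraph S T).Reachable k l := by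
    intro t ht h0 k l hk hl
    obtain ⟨u, hu, hsub⟩ := mem_nhdsLT_iff_exists_Ioo_subset.1
      ((hk.and hl).and (Ioo_mem_nhdsLT h0))
    exact reachable_of_overlap hT hTS hα hne (Set.mem_Iio.1 hu) fun s hs =>
      ⟨⟨(hsub hs).2.1.le, hs.2.le.trans ht.2⟩, (hsub hs).1⟩
  have hRR : ∀ t ∈ Set.Icc (0 : ℝ) 1, ∀ k l, R t k → R t l →
      (bridgeGraph S T).Reachable k l := by
    rintro t ht k l (⟨h1, hk⟩ | ⟨h0, hk⟩) (⟨h1', hl⟩ | ⟨h0', hl⟩)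
    · exact hrr t ht h1 k l hk hl
    · exact (reachable_of_passage hT hTS hα hαS hne ⟨h0', h1⟩ hl hk).symm
    · exact reachable_of_passage hT hTS hα hαS hne ⟨h0, h1'⟩ hk hl
    · exact hll t ht h0 k l hk hl
  -- a set that contains the path near `t` is in the component of all germs at `t`
  have hnear : ∀ t ∈ Set.Icc (0 : ℝ) 1, ∀ k l, (∀ᶠ s in 𝓝 t, α s ∈ T k) → R t l →
      (bridgeGraph S T).Reachable k l := by
    rintro t ht k l hk (⟨h1, hl⟩ | ⟨h0, hl⟩)
    · exact hrr t ht h1 k l (hk.filter_mono nhdsWithin_le_nhds) hl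
    · exact hll t ht h0 k l (hk.filter_mono nhdsWithin_le_nhds) hl
  have hP : ∀ k l, R 0 k → R 1 l → (bridgeGraph S T).Reachable k l := by
    refine isPreconnected_Icc.induction₂' (s := Set.Icc (0 : ℝ) 1)
      (fun x y => ∀ k l, R x k → R y l → (bridgeGraph S T).Reachable k l) ?_ ?_
      ⟨le_rfl, zero_le_one⟩ ⟨zero_le_one, le_rfl⟩
    · intro x hx
      have hgt : ∀ᶠ y in 𝓝[>] x, y ∈ Set.Icc (0 : ℝ) 1 →
          ∀ k l, R x k → R y l → (bridgeGraph S T).Reachable k l := by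
        rcases lt_or_ge x 1 with h1 | h1
        · obtain ⟨m, hm⟩ := hright x ⟨hx.1, h1⟩
          obtain ⟨v, hv, hsub⟩ := mem_nhdsGT_iff_exists_Ioo_subset.1 hm
          filter_upwards [Ioo_mem_nhdsGT (Set.mem_Ioi.1 hv)] with y hy hyI k l hk hl
          exact (hRR x hx k m hk (Or.inl ⟨h1, hm⟩)).trans (hnear y hyI m l
            ((isOpen_Ioo.eventually_mem hy).mono fun s hs => hsub hs) hl)
        · filter_upwards [self_mem_nhdsWithin] with y hy hyI
          exact absurd (h1.trans_lt hy) (not_lt.2 hyI.2)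
      have hlt : ∀ᶠ y in 𝓝[<] x, y ∈ Set.Icc (0 : ℝ) 1 →
          ∀ k l, R x k → R y l → (bridgeGraph S T).Reachable k l := by
        rcases lt_or_ge 0 x with h0 | h0
        · obtain ⟨m, hm⟩ := hleft x ⟨h0, hx.2⟩
          obtain ⟨u, hu, hsub⟩ := mem_nhdsLT_iff_exists_Ioo_subset.1 hm
          filter_upwards [Ioo_mem_nhdsLT (Set.mem_Iio.1 hu)] with y hy hyI k l hk hl
          exact (hRR x hx k m hk (Or.inr ⟨h0, hm⟩)).trans (hnear y hyI m l
            ((isOpen_Ioo.eventually_mem hy).mono fun s hs => hsub hs) hl)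
        · filter_upwards [self_mem_nhdsWithin] with y hy hyI
          exact absurd ((Set.mem_Iio.1 hy).trans_le h0) (not_lt.2 hyI.1)
      rw [eventually_nhdsWithin_iff] at hgt hlt ⊢
      filter_upwards [hgt, hlt] with y hy1 hy2 hyI
      have : ∀ k l, R x k → R y l → (bridgeGraph S T).Reachable k l := by
        rcases lt_trichotomy x y with h | h | h
        · exact hy1 h hyI
        · exact h ▸ hRR x hx
        · exact hy2 h hyI
      exact ⟨this, fun k l hk hl => (this l k hl hk).symm⟩
    · intro x y z _ hy _ hxy hyz k l hk hl
      obtain ⟨m, hm⟩ := hRex y hy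
      exact (hxy k m hk hm).trans (hyz m l hm hl)
  exact hP i j (Or.inl ⟨zero_lt_one, hi⟩) (Or.inr ⟨zero_lt_one, hj⟩)

/-! ### Connectedness of the bridge graph -/

theorem vanishingIdeal_singleton_le {n : ℕ} {P : Ideal (MvPolynomial (Fin n) ℝ)} {x : Fin n → ℝ}
    (h : ∀ i, MvPolynomial.X i - MvPolynomial.C (x i) ∈ P) :
    MvPolynomial.vanishingIdeal ℝ {x} ≤ P := by
  intro g hg
  rw [MvPolynomial.mem_vanishingIdeal_singleton_iff, MvPolynomial.aeval_eq_eval] at hg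
  have key : ∀ g : MvPolynomial (Fin n) ℝ, g - MvPolynomial.C (MvPolynomial.eval x g) ∈ P := by
    intro g
    induction g using MvPolynomial.induction_on with
    | C c => simp
    | add p q hp hq =>
      rw [map_add, map_add, add_sub_add_comm]
      exact P.add_mem hp hq
    | mul_X p i hp =>
      have := P.add_mem (P.mul_mem_right (MvPolynomial.X i) hp)
        (P.mul_mem_left (MvPolynomial.C (MvPolynomial.eval x p)) (h i))
      rw [map_mul, MvPolynomial.eval_X, map_mul]
      convert this using 1
      ring
  simpa [hg] using key g

/-- A set of dimension zero that is connected by analytic paths has at most one point: the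
polynomials that vanish along a nonconstant analytic path in it form a prime ideal that is not
maximal. -/
theorem subsingleton_of_semialgDim_zero {n : ℕ} {S : Set (Fin n → ℝ)} (hdim : semialgDim S = 0)
    (hpath : ConnectedByAnalyticPaths S) : S.Subsingleton := by
  intro x hx y hy
  obtain ⟨α, hα, hαS, rfl, rfl⟩ := hpath x hx y hy
  by_contra hne
  have h0 : (0 : ℝ) ∈ Set.Icc (0 : ℝ) 1 := ⟨le_rfl, zero_le_one⟩
  let f : Fin n → analyticFun := fun i => ⟨fun s => α s i, analyticAt_pi_iff.1 (hα 0 h0) i⟩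
  let P : Ideal (MvPolynomial (Fin n) ℝ) :=
    RingHom.ker (MvPolynomial.aeval (fun i => germ (f i)) : MvPolynomial (Fin n) ℝ →ₐ[ℝ] AGerm)
  have hPprime : P.IsPrime := RingHom.ker_isPrime _
  have hPmem : ∀ g, g ∈ P ↔ ∀ᶠ s in 𝓝 0, MvPolynomial.eval (α s) g = 0 := fun g => by
    rw [RingHom.mem_ker, aeval_germ, germ_eq_zero]
    simp only [coe_aeval_apply]
    rfl
  have hSP : MvPolynomial.vanishingIdeal ℝ S ≤ P := fun g hg => by
    rw [hPmem]
    have h1 : ∀ᶠ s in 𝓝[>] (0 : ℝ), MvPolynomial.eval (α s) g = 0 := by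
      filter_upwards [Ioo_mem_nhdsGT (zero_lt_one (α := ℝ))] with s hs
      exact hg _ (hαS ⟨hs.1.le, hs.2.le⟩)
    refine (((hα 0 h0).eval_mvPolynomial g).frequently_zero_iff_eventually_zero).1 ?_
    exact h1.frequently.filter_mono (nhdsWithin_mono _ fun s hs => ne_of_gt hs)
  have hPQ : P ≤ MvPolynomial.vanishingIdeal ℝ {α 0} := fun g hg => by
    rw [MvPolynomial.mem_vanishingIdeal_singleton_iff]
    exact ((hPmem g).1 hg).self_of_nhds
  have hlt : P < MvPolynomial.vanishingIdeal ℝ {α 0} := by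
    refine lt_of_le_of_ne hPQ fun heq => hne ?_
    refine hα.endpoints_eq h0 (c := α 0) fun i => ?_
    have h1 : MvPolynomial.X i - MvPolynomial.C (α 0 i) ∈ P := by
      rw [heq, MvPolynomial.mem_vanishingIdeal_singleton_iff]
      simp
    filter_upwards [(hPmem _).1 h1] with s hs
    simpa [sub_eq_zero] using hs
  have hdim1 : 1 ≤ semialgDim S := by
    rw [semialgDim, ringKrullDim_quotient, Order.one_le_krullDim_iff]
    exact ⟨⟨⟨P, hPprime⟩, hSP⟩, ⟨MvPolynomial.pointToPoint (α 0), hSP.trans hPQ⟩, hlt⟩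
  rw [hdim] at hdim1
  exact absurd hdim1 (by norm_num)

theorem exists_eval_ne_zero {n : ℕ} {A : Set (Fin n → ℝ)} {P : Ideal (MvPolynomial (Fin n) ℝ)}
    (hAP : MvPolynomial.vanishingIdeal ℝ A ≤ P) {g : MvPolynomial (Fin n) ℝ} (hg : g ∉ P) :
    ∃ x ∈ A, MvPolynomial.eval x g ≠ 0 := by
  by_contra! h
  exact hg (hAP h)

theorem mainTheorem10 (n d r : ℕ) (S : Set (Fin n → ℝ)) (T : Fin r → Set (Fin n → ℝ))
    (hS : IsSemialgebraic S) (hdim : semialgDim S = d)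
    (hT : ∀ i, IsSemialgebraic (T i)) (hTconn : ∀ i, IsConnected (T i))
    (hTopen : ∀ i, ∃ U : Set (Fin n → ℝ), IsOpen U ∧ T i = U ∩ semialgReg S)
    (hTdim : ∀ i, semialgDim (T i) = d)
    (hTS : (⋃ i, T i) ⊆ S) (hST : S ⊆ closure (⋃ i, T i))
    (hpath : ConnectedByAnalyticPaths S)
    (hzero : d = 0 → Function.Injective T) :
    (bridgeGraph S T).Connected := by
  have hTS' : ∀ i, T i ⊆ S := fun i => (Set.subset_iUnion T i).trans hTS
  have hSne : S.Nonempty := by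
    rw [Set.nonempty_iff_ne_empty]
    rintro rfl
    rw [semialgDim, MvPolynomial.vanishingIdeal_empty,
      ringKrullDim_eq_bot_of_subsingleton] at hdim
    exact absurd hdim (WithBot.bot_ne_coe)
  obtain ⟨i₀⟩ : Nonempty (Fin r) := by
    obtain ⟨x, hx⟩ := hSne
    obtain ⟨y, hy⟩ := closure_nonempty_iff.1 ⟨x, hST hx⟩
    exact ⟨(Set.mem_iUnion.1 hy).choose⟩
  refine (SimpleGraph.connected_iff _).2 ⟨fun i j => ?_, ⟨i₀⟩⟩
  rcases eq_or_ne d 0 with hd | hd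
  · subst hd
    have hsub := subsingleton_of_semialgDim_zero hdim hpath
    have hone : ∀ k, T k = S := fun k => by
      refine (hTS' k).antisymm fun x hx => ?_
      obtain ⟨y, hy⟩ := (hTconn k).nonempty
      exact hsub hx (hTS' k hy) ▸ hy
    rw [hzero rfl ((hone i).trans (hone j).symm)]
  -- a polynomial whose nonzero set in `S` consists of generic points, nonzero somewhere on `T k`
  have hgen : ∀ k, ∃ P : Ideal (MvPolynomial (Fin n) ℝ), P.IsPrime ∧ ¬ P.IsMaximal ∧
      MvPolynomial.vanishingIdeal ℝ (T k) ≤ P ∧ ∃ g ∉ P, ∀ x ∈ S, MvPolynomial.eval x g ≠ 0 →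
        ∀ᶠ x' in 𝓝[S] x, ∀ l, (x' ∈ T l ↔ x ∈ T l) := fun k => by
    obtain ⟨P, hP, hTP, hmax⟩ := exists_minimalPrime_of_ringKrullDim_eq
      (MvPolynomial.vanishingIdeal_anti_mono (hTS' k)) hdim (hTdim k)
    exact ⟨P, hP.1.1, hmax hd, hTP, exists_generic_polynomial S hT hP⟩
  obtain ⟨P, -, -, hTP, g, hgP, hg⟩ := hgen i
  obtain ⟨Q, hQ, hQmax, hTQ, g', hgQ, hg'⟩ := hgen j
  obtain ⟨x, hxT, hxg⟩ := exists_eval_ne_zero hTP hgP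
  -- the end point is chosen different from the initial point
  obtain ⟨m, hm⟩ : ∃ m, MvPolynomial.X m - MvPolynomial.C (x m) ∉ Q := by
    by_contra! h
    have hmax : (MvPolynomial.vanishingIdeal ℝ {x}).IsMaximal := inferInstance
    exact hQmax (hmax.eq_of_le hQ.ne_top (vanishingIdeal_singleton_le h) ▸ hmax)
  obtain ⟨y, hyT, hyg⟩ := exists_eval_ne_zero hTQ
    (fun h => (hQ.mem_or_mem h).elim hgQ hm : g' * (MvPolynomial.X m - MvPolynomial.C (x m)) ∉ Q)
  rw [map_mul] at hyg
  have hxy : x ≠ y := fun h => right_ne_zero_of_mul hyg (by simp [h])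
  obtain ⟨α, hα, hαS, hα0, hα1⟩ := hpath x (hTS' i hxT) y (hTS' j hyT)
  have hcover : ∀ x ∈ S, MvPolynomial.eval x g ≠ 0 → ∃ k, x ∈ T k := fun z hz hzg => by
    have h1 : ∃ᶠ z' in 𝓝 z, z' ∈ ⋃ k, T k := mem_closure_iff_frequently.1 (hST hz)
    obtain ⟨z', h2, h3⟩ := (h1.and_eventually (eventually_nhdsWithin_iff.1 (hg z hz hzg))).exists
    obtain ⟨k, hk⟩ := Set.mem_iUnion.1 h2
    exact ⟨k, (h3 (hTS h2) k).1 hk⟩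
  have h0 : (0 : ℝ) ∈ Set.Icc (0 : ℝ) 1 := ⟨le_rfl, zero_le_one⟩
  have h1 : (1 : ℝ) ∈ Set.Icc (0 : ℝ) 1 := ⟨zero_le_one, le_rfl⟩
  have hright : Tendsto α (𝓝[>] 0) (𝓝[S] x) := by
    refine tendsto_nhdsWithin_iff.2 ⟨?_, ?_⟩
    · exact hα0 ▸ (hα 0 h0).continuousAt.tendsto.mono_left nhdsWithin_le_nhds
    · filter_upwards [Ioo_mem_nhdsGT (zero_lt_one (α := ℝ))] with s hs
      exact hαS ⟨hs.1.le, hs.2.le⟩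
  have hleft : Tendsto α (𝓝[<] 1) (𝓝[S] y) := by
    refine tendsto_nhdsWithin_iff.2 ⟨?_, ?_⟩
    · exact hα1 ▸ (hα 1 h1).continuousAt.tendsto.mono_left nhdsWithin_le_nhds
    · filter_upwards [Ioo_mem_nhdsLT (zero_lt_one (α := ℝ))] with s hs
      exact hαS ⟨hs.1.le, hs.2.le⟩
  refine reachable_of_path hT hTS' hα hαS (by rwa [hα0, hα1]) (hα0 ▸ hxg) hcover ?_ ?_
  · exact (hright.eventually (hg x (hTS' i hxT) hxg)).mono fun s hs => (hs i).2 hxT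
  · exact (hleft.eventually (hg' y (hTS' j hyT) (left_ne_zero_of_mul hyg))).mono
      fun s hs => (hs j).2 hyT
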